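/- Let $\mathcal T_h$ be a finite conforming triangulation in $\mathbb R^2$, i.e. a finite geometric simplicial complex in $\mathbb R^2$ each of whose simplices is contained in a triangle of the complex, and let $\Omega$ be the interior of the union of its (closed) triangles. Let $\mathcal V$, $\mathcal E$, $\mathcal F$ denote its sets of vertices, edges (interior and boundary) and triangles, let $\mathcal P_p$ be the space of polynomials in two variables of total degree at most $p$, and for $e\in\mathcal E$ let $\boldsymbol\nu_e$ be a unit normal vector of $e$. Let $H(\mathrm{div};\Omega)$ be the space of all $\boldsymbol v\in L^2(\Omega;\mathbb R^2)$ whose weak divergence belongs to $L^2(\Omega)$. Define the following subspaces of $L^2(\Omega;\mathbb R^2)$: $$\mathcal P_{1,p}\Lambda^1(\mathcal T_h^2)=\{\boldsymbol v\in H(\mathrm{div};\Omega):\ \boldsymbol v|_f\in(\mathcal P_p)^2\ \ \forall f\in\mathcal F;\ \boldsymbol v\text{ is continuous at every vertex } x\in\mathcal V\},$$ where continuity at $x$ means that $\boldsymbol v(y)$ has an (essential) limit as $y\to x$, $y\in\Omega$; $$\boldsymbol L_h^p=\{\boldsymbol v\in C^0(\overline\Omega;\mathbb R^2):\ \boldsymbol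 v|_f\in(\mathcal P_p)^2\ \ \forall f\in\mathcal F\}$$ (the vector Lagrange element space of degree $p$); and $$\boldsymbol\Sigma_b^p=\{\boldsymbol B\in\mathcal P_{1,p}\Lambda^1(\mathcal T_h^2):\ \boldsymbol B\cdot\boldsymbol\nu_e=0\ \text{on } e\ \ \forall e\in\mathcal E\},$$ where the values of $\boldsymbol B$ on $e$ are those of the polynomial field $\boldsymbol B|_f$, for every triangle $f$ that contains $e$. Then for every $p\ge 2$ $$\mathcal P_{1,p}\Lambda^1(\mathcal T_h^2)=\boldsymbol L_h^p+\boldsymbol\Sigma_b^p .$$ -/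

import Mathlib

noncomputable section

namespace StenbergDiv

open MeasureTheory Filter Topology Geometry
open scoped ContDiff

/-- The Euclidean plane `ℝ²`. -/
abbrev Plane : Type := EuclideanSpace ℝ (Fin 2)

/-- `K` is a finite (conforming) triangulation: a finite simplicial complex in the plane in which
every simplex is contained in a triangle. -/
structure IsTriangulation (K : SimplicialComplex ℝ Plane) : Prop where
  finite : K.faces.Finite
  pure : ∀ s ∈ K.faces, ∃ f ∈ K.faces, f.card = 3 ∧ s ⊆ f

/-- The triangles of the mesh, each given by its set of three vertices. -/
def triangles (K : SimplicialComplex ℝ Plane) : Set (Finset Plane) :=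
  {f | f ∈ K.faces ∧ f.card = 3}

/-- The edges of the mesh (interior and boundary), each given by its set of two endpoints. -/
def edges (K : SimplicialComplex ℝ Plane) : Set (Finset Plane) :=
  {e | e ∈ K.faces ∧ e.card = 2}

/-- The polygonal domain `Ω` that is triangulated: the interior of the union of the triangles. -/
def domain (K : SimplicialComplex ℝ Plane) : Set Plane := interior K.space

/-- The space `L²(Ω; ℝ²)`. -/
abbrev L2 (K : SimplicialComplex ℝ Plane) : Type := Lp Plane 2 (volume.restrict (domain K))

/-- The polynomial vector field with components `q 0` and `q 1`. -/
def polyField (q : Fin 2 → MvPolynomial (Fin 2) ℝ) (x : Plane) : Plane :=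
  WithLp.toLp 2 fun i => MvPolynomial.eval x.ofLp (q i)

theorem polyField_zero : polyField 0 = 0 := by
  ext x i; simp [polyField]

theorem polyField_add (q r : Fin 2 → MvPolynomial (Fin 2) ℝ) :
    polyField (q + r) = polyField q + polyField r := by
  ext x i; simp [polyField]

theorem polyField_smul (c : ℝ) (q : Fin 2 → MvPolynomial (Fin 2) ℝ) :
    polyField (c • q) = c • polyField q := by
  ext x i; simp [polyField, MvPolynomial.smul_eval]

/-- `q ∈ (P_p)²`: both components have total degree at most `p`. -/
def polys (p : ℕ) : Submodule ℝ (Fin 2 → MvPolynomial (Fin 2) ℝ) where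
  carrier := {q | ∀ i, (q i).totalDegree ≤ p}
  zero_mem' := fun i => by simp
  add_mem' := fun {a b} ha hb i =>
    (MvPolynomial.totalDegree_add (a i) (b i)).trans (max_le (ha i) (hb i))
  smul_mem' := fun c a ha i => (MvPolynomial.totalDegree_smul_le c (a i)).trans (ha i)

/-- The restriction of `v` to the (open) triangle with vertex set `f` is the polynomial field `q`,
as an equality of classes of functions modulo null sets. -/
def RestrictsTo (K : SimplicialComplex ℝ Plane) (v : L2 K) (f : Finset Plane)
    (q : Fin 2 → MvPolynomial (Fin 2) ℝ) : Prop :=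
  v =ᵐ[volume.restrict (interior (convexHull ℝ (f : Set Plane)))] polyField q

/-- `φ ∈ C_c^∞(Ω)`, as a function on the plane. -/
structure IsTestFunction (Ω : Set Plane) (φ : Plane → ℝ) : Prop where
  smooth : ContDiff ℝ ∞ φ
  compact : HasCompactSupport φ
  support : tsupport φ ⊆ Ω

/-- `w ∈ L²(Ω)` is the weak divergence of `v`: `∫_Ω v · ∇φ = - ∫_Ω w φ` for all `φ ∈ C_c^∞(Ω)`;
here `fderiv ℝ φ x (v x)` is `v(x) · ∇φ(x)`. -/
def IsWeakDiv (K : SimplicialComplex ℝ Plane) (v : L2 K)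
    (w : Lp ℝ 2 (volume.restrict (domain K))) : Prop :=
  ∀ φ : Plane → ℝ, IsTestFunction (domain K) φ →
    ∫ x in domain K, fderiv ℝ φ x (v x) = -∫ x in domain K, w x * φ x

theorem interior_triangle_subset (K : SimplicialComplex ℝ Plane) {f : Finset Plane}
    (hf : f ∈ K.faces) : interior (convexHull ℝ (f : Set Plane)) ⊆ domain K :=
  interior_mono (SimplicialComplex.convexHull_subset_space hf)

theorem ae_triangle {K : SimplicialComplex ℝ Plane} {f : Finset Plane} (hf : f ∈ K.faces)
    {P : Plane → Prop} (h : ∀ᵐ x ∂(volume.restrict (domain K)), P x) :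
    ∀ᵐ x ∂(volume.restrict (interior (convexHull ℝ (f : Set Plane)))), P x :=
  ae_mono (Measure.restrict_mono (interior_triangle_subset K hf) le_rfl) h

theorem RestrictsTo.zero {K : SimplicialComplex ℝ Plane} {f : Finset Plane} (hf : f ∈ K.faces) :
    RestrictsTo K 0 f 0 := by
  filter_upwards [ae_triangle hf (Lp.coeFn_zero Plane 2 (volume.restrict (domain K)))] with x hx
  rw [hx, polyField_zero]

theorem RestrictsTo.add {K : SimplicialComplex ℝ Plane} {f : Finset Plane} (hf : f ∈ K.faces)
    {v w : L2 K} {q r : Fin 2 → MvPolynomial (Fin 2) ℝ} (hv : RestrictsTo K v f q)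
    (hw : RestrictsTo K w f r) : RestrictsTo K (v + w) f (q + r) := by
  filter_upwards [ae_triangle hf (Lp.coeFn_add v w), hv, hw] with x hx h1 h2
  rw [hx, polyField_add, Pi.add_apply, Pi.add_apply, h1, h2]

theorem RestrictsTo.smul {K : SimplicialComplex ℝ Plane} {f : Finset Plane} (hf : f ∈ K.faces)
    (c : ℝ) {v : L2 K} {q : Fin 2 → MvPolynomial (Fin 2) ℝ} (hv : RestrictsTo K v f q) :
    RestrictsTo K (c • v) f (c • q) := by
  filter_upwards [ae_triangle hf (Lp.coeFn_smul c v), hv] with x hx h1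
  rw [hx, polyField_smul, Pi.smul_apply, Pi.smul_apply, h1]

theorem IsTestFunction.memLp {Ω : Set Plane} {φ : Plane → ℝ} (h : IsTestFunction Ω φ) :
    MemLp φ 2 (volume.restrict Ω) :=
  (h.smooth.continuous.memLp_of_hasCompactSupport h.compact).restrict Ω

theorem IsTestFunction.memLp_fderiv {Ω : Set Plane} {φ : Plane → ℝ} (h : IsTestFunction Ω φ) :
    MemLp (fderiv ℝ φ) 2 (volume.restrict Ω) :=
  ((h.smooth.continuous_fderiv (by simp)).memLp_of_hasCompactSupport
    (h.compact.fderiv (𝕜 := ℝ))).restrict Ω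

theorem IsTestFunction.integrable_mul {K : SimplicialComplex ℝ Plane} {φ : Plane → ℝ}
    (h : IsTestFunction (domain K) φ) (w : Lp ℝ 2 (volume.restrict (domain K))) :
    Integrable (fun x => w x * φ x) (volume.restrict (domain K)) :=
  (Lp.memLp w).integrable_mul h.memLp

theorem IsTestFunction.integrable_fderiv {K : SimplicialComplex ℝ Plane} {φ : Plane → ℝ}
    (h : IsTestFunction (domain K) φ) (v : L2 K) :
    Integrable (fun x => fderiv ℝ φ x (v x)) (volume.restrict (domain K)) := by
  refine (h.memLp_fderiv.norm.integrable_mul (Lp.memLp v).norm).mono' ?_ ?_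
  · exact isBoundedBilinearMap_apply.continuous.comp_aestronglyMeasurable
      (h.memLp_fderiv.aestronglyMeasurable.prodMk (Lp.aestronglyMeasurable v))
  · exact Eventually.of_forall fun x => (fderiv ℝ φ x).le_opNorm (v x)

theorem IsWeakDiv.zero (K : SimplicialComplex ℝ Plane) : IsWeakDiv K 0 0 := by
  intro φ _
  have h1 : ∫ x in domain K, fderiv ℝ φ x ((0 : L2 K) x) = 0 := by
    refine integral_eq_zero_of_ae ?_
    filter_upwards [Lp.coeFn_zero Plane 2 (volume.restrict (domain K))] with x hx
    rw [hx]; simp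
  have h2 : ∫ x in domain K, (0 : Lp ℝ 2 (volume.restrict (domain K))) x * φ x = 0 := by
    refine integral_eq_zero_of_ae ?_
    filter_upwards [Lp.coeFn_zero ℝ 2 (volume.restrict (domain K))] with x hx
    rw [hx]; simp
  rw [h1, h2, neg_zero]

theorem IsWeakDiv.add {K : SimplicialComplex ℝ Plane} {v v' : L2 K}
    {w w' : Lp ℝ 2 (volume.restrict (domain K))} (h : IsWeakDiv K v w) (h' : IsWeakDiv K v' w') :
    IsWeakDiv K (v + v') (w + w') := by
  intro φ hφ
  have h1 : ∫ x in domain K, fderiv ℝ φ x ((v + v' : L2 K) x) =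
      (∫ x in domain K, fderiv ℝ φ x (v x)) + ∫ x in domain K, fderiv ℝ φ x (v' x) := by
    rw [← integral_add (hφ.integrable_fderiv v) (hφ.integrable_fderiv v')]
    refine integral_congr_ae ?_
    filter_upwards [Lp.coeFn_add v v'] with x hx
    rw [hx]; simp
  have h2 : ∫ x in domain K, (w + w' : Lp ℝ 2 (volume.restrict (domain K))) x * φ x =
      (∫ x in domain K, w x * φ x) + ∫ x in domain K, w' x * φ x := by
    rw [← integral_add (hφ.integrable_mul w) (hφ.integrable_mul w')]
    refine integral_congr_ae ?_
    filter_upwards [Lp.coeFn_add w w'] with x hx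
    rw [hx]; simp [add_mul]
  rw [h1, h2, h φ hφ, h' φ hφ, neg_add]

theorem IsWeakDiv.smul {K : SimplicialComplex ℝ Plane} (c : ℝ) {v : L2 K}
    {w : Lp ℝ 2 (volume.restrict (domain K))} (h : IsWeakDiv K v w) :
    IsWeakDiv K (c • v) (c • w) := by
  intro φ hφ
  have h1 : ∫ x in domain K, fderiv ℝ φ x ((c • v : L2 K) x) =
      c * ∫ x in domain K, fderiv ℝ φ x (v x) := by
    rw [← integral_const_mul]
    refine integral_congr_ae ?_
    filter_upwards [Lp.coeFn_smul c v] with x hx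
    simp [hx]
  have h2 : ∫ x in domain K, (c • w : Lp ℝ 2 (volume.restrict (domain K))) x * φ x =
      c * ∫ x in domain K, w x * φ x := by
    rw [← integral_const_mul]
    refine integral_congr_ae ?_
    filter_upwards [Lp.coeFn_smul c w] with x hx
    simp [hx, mul_assoc]
  rw [h1, h2, h φ hφ, mul_neg]

/-- `H(div; Ω)`: the fields in `L²(Ω; ℝ²)` with weak divergence in `L²(Ω)`. -/
def Hdiv (K : SimplicialComplex ℝ Plane) : Submodule ℝ (L2 K) where
  carrier := {v | ∃ w, IsWeakDiv K v w}
  zero_mem' := ⟨0, IsWeakDiv.zero K⟩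
  add_mem' := fun ⟨w, hw⟩ ⟨w', hw'⟩ => ⟨w + w', hw.add hw'⟩
  smul_mem' := fun c _ ⟨w, hw⟩ => ⟨c • w, hw.smul c⟩

/-- The fields whose restriction to every triangle of the mesh belongs to `(P_p)²`. -/
def piecewisePoly (K : SimplicialComplex ℝ Plane) (p : ℕ) : Submodule ℝ (L2 K) where
  carrier := {v | ∀ f ∈ triangles K, ∃ q ∈ polys p, RestrictsTo K v f q}
  zero_mem' := fun f hf => ⟨0, zero_mem _, RestrictsTo.zero hf.1⟩
  add_mem' := fun {v w} hv hw f hf => by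
    obtain ⟨q, hq, h⟩ := hv f hf
    obtain ⟨r, hr, h'⟩ := hw f hf
    exact ⟨q + r, add_mem hq hr, h.add hf.1 h'⟩
  smul_mem' := fun c v hv f hf => by
    obtain ⟨q, hq, h⟩ := hv f hf
    exact ⟨c • q, Submodule.smul_mem _ c hq, h.smul hf.1 c⟩

/-- `v ∈ C⁰(𝒱)`: `v` is continuous at every vertex `x` of the mesh, that is, `v(y)` has a limit as
`y → x` in `Ω`. Since `v` is a class of functions modulo null sets, this is an essential limit:
for some `c` and every `ε > 0` there is `δ > 0` with `|v(y) - c| < ε` for almost every `y ∈ Ω` with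
`|y - x| < δ`. -/
def continuousAtVertices (K : SimplicialComplex ℝ Plane) : Submodule ℝ (L2 K) where
  carrier := {v | ∀ x ∈ K.vertices,
    ∃ c : Plane, Tendsto v (𝓝 x ⊓ ae (volume.restrict (domain K))) (𝓝 c)}
  zero_mem' := fun x _ => ⟨0, by
    refine (tendsto_const_nhds (x := (0 : Plane))).congr' ?_
    refine (inf_le_right : 𝓝 x ⊓ ae (volume.restrict (domain K)) ≤ _) ?_
    filter_upwards [Lp.coeFn_zero Plane 2 (volume.restrict (domain K))] with y hy
    exact hy.symm⟩
  add_mem' := fun {v w} hv hw x hx => by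
    obtain ⟨c, hc⟩ := hv x hx
    obtain ⟨d, hd⟩ := hw x hx
    refine ⟨c + d, (hc.add hd).congr' ?_⟩
    refine (inf_le_right : 𝓝 x ⊓ ae (volume.restrict (domain K)) ≤ _) ?_
    filter_upwards [Lp.coeFn_add v w] with y hy
    exact hy.symm
  smul_mem' := fun a v hv x hx => by
    obtain ⟨c, hc⟩ := hv x hx
    refine ⟨a • c, (hc.const_smul a).congr' ?_⟩
    refine (inf_le_right : 𝓝 x ⊓ ae (volume.restrict (domain K)) ≤ _) ?_
    filter_upwards [Lp.coeFn_smul a v] with y hy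
    exact hy.symm

/-- The two-dimensional Stenberg space `P_{1,p}Λ¹(T_h²)`. -/
def stenberg (K : SimplicialComplex ℝ Plane) (p : ℕ) : Submodule ℝ (L2 K) :=
  Hdiv K ⊓ piecewisePoly K p ⊓ continuousAtVertices K

/-- The vector Lagrange space `L_h^p`: (the classes of) the continuous fields on the closed
triangulated region that are in `(P_p)²` on every closed triangle. -/
def lagrange (K : SimplicialComplex ℝ Plane) (p : ℕ) : Submodule ℝ (L2 K) where
  carrier := {v | ∃ g : Plane → Plane, ContinuousOn g K.space ∧
    (∀ f ∈ triangles K, ∃ q ∈ polys p, Set.EqOn g (polyField q) (convexHull ℝ (f : Set Plane))) ∧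
    v =ᵐ[volume.restrict (domain K)] g}
  zero_mem' := ⟨0, continuousOn_const,
    fun _ _ => ⟨0, zero_mem _, by rw [polyField_zero]; exact Set.eqOn_refl _ _⟩,
    Lp.coeFn_zero Plane 2 (volume.restrict (domain K))⟩
  add_mem' := by
    rintro v w ⟨g, hg, hgp, hvg⟩ ⟨g', hg', hgp', hvg'⟩
    refine ⟨g + g', hg.add hg', fun f hf => ?_, ?_⟩
    · obtain ⟨q, hq, h⟩ := hgp f hf
      obtain ⟨r, hr, h'⟩ := hgp' f hf
      refine ⟨q + r, add_mem hq hr, fun x hx => ?_⟩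
      rw [polyField_add, Pi.add_apply, Pi.add_apply, h hx, h' hx]
    · exact (Lp.coeFn_add v w).trans (hvg.add hvg')
  smul_mem' := by
    rintro c v ⟨g, hg, hgp, hvg⟩
    refine ⟨c • g, hg.const_smul c, fun f hf => ?_, ?_⟩
    · obtain ⟨q, hq, h⟩ := hgp f hf
      refine ⟨c • q, Submodule.smul_mem _ c hq, fun x hx => ?_⟩
      rw [polyField_smul, Pi.smul_apply, Pi.smul_apply, h hx]
    · exact (Lp.coeFn_smul c v).trans (hvg.const_smul c)

/-- `ν` is a unit normal vector of the edge with endpoints `e`. -/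
def IsUnitNormal (e : Finset Plane) (ν : Plane) : Prop :=
  ‖ν‖ = 1 ∧ ∀ a ∈ e, ∀ b ∈ e, inner ℝ (b - a) ν = 0

/-- The bubble space `Σ_b^p`: the fields `B` in the Stenberg space with `B · ν_e = 0` on every edge
`e`. The value of `B` on `e` is the trace, taken from each triangle `f` that contains `e`, of the
polynomial field `q` that `B` is on `f`. -/
def bubble (K : SimplicialComplex ℝ Plane) (p : ℕ) : Submodule ℝ (L2 K) where
  carrier := {B | B ∈ stenberg K p ∧
    ∀ e ∈ edges K, ∀ ν, IsUnitNormal e ν → ∀ f ∈ triangles K, e ⊆ f →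
      ∃ q, RestrictsTo K B f q ∧
        ∀ x ∈ convexHull ℝ (e : Set Plane), inner ℝ (polyField q x) ν = 0}
  zero_mem' := ⟨zero_mem _, fun e _ ν _ f hf _ =>
    ⟨0, RestrictsTo.zero hf.1, fun x _ => by simp [polyField_zero]⟩⟩
  add_mem' := by
    rintro v w ⟨hv, hv'⟩ ⟨hw, hw'⟩
    refine ⟨add_mem hv hw, fun e he ν hν f hf hef => ?_⟩
    obtain ⟨q, hq, h⟩ := hv' e he ν hν f hf hef
    obtain ⟨r, hr, h'⟩ := hw' e he ν hν f hf hef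
    refine ⟨q + r, hq.add hf.1 hr, fun x hx => ?_⟩
    rw [polyField_add, Pi.add_apply, inner_add_left, h x hx, h' x hx, add_zero]
  smul_mem' := by
    rintro c v ⟨hv, hv'⟩
    refine ⟨Submodule.smul_mem _ c hv, fun e he ν hν f hf hef => ?_⟩
    obtain ⟨q, hq, h⟩ := hv' e he ν hν f hf hef
    refine ⟨c • q, hq.smul hf.1 c, fun x hx => ?_⟩
    rw [polyField_smul, Pi.smul_apply, inner_smul_left, h x hx, mul_zero]

end StenbergDiv

end

noncomputable section

namespace StenbergDiv

open MeasureTheory Filter Topology Geometry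
open scoped ContDiff NNReal

/-! The substance is that a Stenberg field `v` splits triangle by triangle. Let `q` be its
polynomial on a triangle. For an edge with barycentric coordinates `La`, `Lb` at its ends, a
multiple of `La * Lb` times the edge tangent vanishes on the other two edges and has no normal
component on its own. Since `2 ≤ p`, such fields of degree at most `p` can remove from the
tangential trace of `q` everything but the linear interpolant of its end values
(`exists_edge_correction`, `exists_edgeTrace`). The corrected polynomial `r` keeps the vertex values
and the normal traces of `q`.

The polynomials `r` of two triangles agree on their intersection. Normal components match because
`v` is in H(div), and tangential components match because they depend only on the vertex values,
which continuity at the vertices makes common (`polyField_eq_of_edgeTrace`). So they glue to a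
Lagrange field, and `q - r` has zero normal trace on every edge.

Matching of normal components (`inner_eq_of_weakDiv`) is a blow-up argument. The weak divergence is
tested against a radial bump shrunk to radius `ε` about a point of an open edge. By Cauchy–Schwarz
the side with the divergence is `o(ε)`. The other side is `ε` times an integral whose limit is a
nonzero multiple of the normal jump.

That the remainder is again a Stenberg field uses the reverse inclusion `lagrange_le_stenberg`. Its
main point is `lagrange_le_Hdiv`: a test function times a component of a Lagrange field is Lipschitz
with compact support, so its directional derivatives integrate to zero. -/

/-! ### Barycentric coordinates in the plane. -/

/-- Twice the signed area of the triangle `a b c`. -/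
def cross (a b c : Plane) : ℝ := (b 0 - a 0) * (c 1 - a 1) - (b 1 - a 1) * (c 0 - a 0)

theorem cross_rotate (a b c : Plane) : cross b c a = cross a b c := by
  simp only [cross]; ring

theorem cross_left (a b : Plane) : cross a b a = 0 := by
  simp only [cross]; ring

theorem cross_right (a b : Plane) : cross a b b = 0 := by
  simp only [cross]; ring

theorem continuous_cross (a b : Plane) : Continuous (cross a b) := by
  unfold cross; fun_prop

theorem cross_add_cross_add_cross (a b c y : Plane) :
    cross b c y + cross c a y + cross a b y = cross a b c := by
  simp only [cross]; ring

theorem cross_combination (a b x y : Plane) (s t : ℝ) (hst : s + t = 1) :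
    cross a b (s • x + t • y) = s * cross a b x + t * cross a b y := by
  obtain rfl : s = 1 - t := by linarith
  simp only [cross, PiLp.add_apply, PiLp.smul_apply, smul_eq_mul]; ring

/-- The barycentric expansion of `y` with denominators cleared, so that no nondegeneracy is needed.
-/
theorem cross_smul_eq (a b c y : Plane) :
    cross a b c • y = cross b c y • a + cross c a y • b + cross a b y • c := by
  ext i
  fin_cases i <;>
    simp only [cross, Fin.zero_eta, Fin.mk_one, PiLp.add_apply, PiLp.smul_apply, smul_eq_mul] <;>
    ring

theorem cross_ne_zero {a b c : Plane} (h : AffineIndependent ℝ ![a, b, c]) : cross a b c ≠ 0 := by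
  intro h0
  rw [affineIndependent_iff_not_collinear_set] at h
  apply h
  by_cases hab : b = a
  · subst hab
    rw [Set.insert_eq_of_mem (by simp)]
    exact collinear_pair ℝ b c
  rw [collinear_iff_of_mem (p₀ := a) (by simp)]
  have hpos : (b 0 - a 0) ^ 2 + (b 1 - a 1) ^ 2 ≠ 0 := by
    intro h
    apply hab
    have h1 : b 0 - a 0 = 0 := by nlinarith [sq_nonneg (b 0 - a 0), sq_nonneg (b 1 - a 1)]
    have h2 : b 1 - a 1 = 0 := by nlinarith [sq_nonneg (b 0 - a 0), sq_nonneg (b 1 - a 1)]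
    ext i
    fin_cases i
    · simpa using sub_eq_zero.1 h1
    · simpa using sub_eq_zero.1 h2
  refine ⟨b - a, ?_⟩
  intro p hp
  rcases hp with rfl | rfl | rfl
  · exact ⟨0, by simp⟩
  · exact ⟨1, by simp⟩
  -- The coefficient is that of the orthogonal projection of `p - a` onto `b - a`.
  · refine ⟨((b 0 - a 0) * (p 0 - a 0) + (b 1 - a 1) * (p 1 - a 1)) /
      ((b 0 - a 0) ^ 2 + (b 1 - a 1) ^ 2), ?_⟩
    simp only [cross] at h0
    ext i
    fin_cases i
    · simp
      field_simp
      linear_combination (-(b 1 - a 1)) * h0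
    · simp
      field_simp
      linear_combination (b 0 - a 0) * h0

/-- A point whose barycentric coordinates are nonnegative belongs to the triangle. -/
theorem mem_triangle {a b c y : Plane} (h : cross a b c ≠ 0)
    (ha : 0 ≤ cross b c y / cross a b c) (hb : 0 ≤ cross c a y / cross a b c)
    (hc : 0 ≤ cross a b y / cross a b c) : y ∈ convexHull ℝ ({a, b, c} : Set Plane) := by
  have hy : y = (cross b c y / cross a b c) • a + (cross c a y / cross a b c) • b +
      (cross a b y / cross a b c) • c := by
    have := congrArg ((cross a b c)⁻¹ • ·) (cross_smul_eq a b c y)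
    simp only [smul_smul, inv_mul_cancel₀ h, one_smul, smul_add] at this
    simpa only [div_eq_inv_mul] using this
  have hs : cross b c y / cross a b c + cross c a y / cross a b c + cross a b y / cross a b c = 1 := by
    rw [← add_div, ← add_div, cross_add_cross_add_cross, div_self h]
  have := (convex_convexHull ℝ ({a, b, c} : Set Plane)).sum_mem (t := Finset.univ)
    (w := ![cross b c y / cross a b c, cross c a y / cross a b c, cross a b y / cross a b c])
    (z := ![a, b, c]) (by intro i _; fin_cases i <;> assumption)
    (by simpa [Fin.sum_univ_three] using hs)
    (by intro i _; apply subset_convexHull; fin_cases i <;> simp)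
  rw [hy]
  simpa [Fin.sum_univ_three] using this

theorem mem_interior_triangle {a b c y : Plane} (h : cross a b c ≠ 0)
    (ha : 0 < cross b c y / cross a b c) (hb : 0 < cross c a y / cross a b c)
    (hc : 0 < cross a b y / cross a b c) :
    y ∈ interior (convexHull ℝ ({a, b, c} : Set Plane)) := by
  rw [mem_interior_iff_mem_nhds]
  have h1 : ∀ a b : Plane, ∀ D : ℝ, Continuous fun y => cross a b y / D := fun a b D =>
    (continuous_cross a b).div_const D
  filter_upwards [(h1 b c (cross a b c)).continuousAt.eventually (lt_mem_nhds ha),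
    (h1 c a (cross a b c)).continuousAt.eventually (lt_mem_nhds hb),
    (h1 a b (cross a b c)).continuousAt.eventually (lt_mem_nhds hc)] with z h1 h2 h3
  exact mem_triangle h h1.le h2.le h3.le

theorem cross_eq_zero_of_mem_segment {a b x : Plane} (hx : x ∈ segment ℝ a b) :
    cross a b x = 0 := by
  obtain ⟨s, t, -, -, hst, rfl⟩ := hx
  rw [cross_combination _ _ _ _ _ _ hst, cross_left, cross_right]; simp

/-- Near an interior point of the edge `a b`, the triangle `a b c` is the half-plane bounded by that
edge. -/
theorem eventually_mem_triangle {a b c x : Plane} (h : cross a b c ≠ 0)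
    (hx : x ∈ openSegment ℝ a b) :
    ∀ᶠ y in 𝓝 x, (0 ≤ cross a b y / cross a b c → y ∈ convexHull ℝ ({a, b, c} : Set Plane)) ∧
      (0 < cross a b y / cross a b c → y ∈ interior (convexHull ℝ ({a, b, c} : Set Plane))) := by
  have h1 : ∀ a b : Plane, ∀ D : ℝ, Continuous fun y => cross a b y / D := fun a b D =>
    (continuous_cross a b).div_const D
  obtain ⟨s, t, hs, ht, hst, rfl⟩ := hx
  -- The barycentric coordinates at `a` and `b` of this point are `s` and `t`. They stay positive
  -- nearby, so the third coordinate alone decides membership.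
  have e1 : 0 < cross b c (s • a + t • b) / cross a b c := by
    rw [cross_combination _ _ _ _ _ _ hst, cross_left, cross_rotate]
    simpa [h] using hs
  have e2 : 0 < cross c a (s • a + t • b) / cross a b c := by
    rw [cross_combination _ _ _ _ _ _ hst, cross_right, ← cross_rotate a b c,
      ← cross_rotate b c a]
    have : cross c a b ≠ 0 := by rwa [cross_rotate b c a, cross_rotate a b c]
    simpa [this] using ht
  filter_upwards [(h1 b c (cross a b c)).continuousAt.eventually (lt_mem_nhds e1),
    (h1 c a (cross a b c)).continuousAt.eventually (lt_mem_nhds e2)] with z h1 h2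
  exact ⟨fun h3 => mem_triangle h h1.le h2.le h3, fun h3 => mem_interior_triangle h h1 h2 h3⟩

/-! ### Triangles of the complex and their relative position. -/

theorem exists_of_mem_triangles {K : SimplicialComplex ℝ Plane} {f : Finset Plane}
    (hf : f ∈ triangles K) : ∃ a b c : Plane, f = {a, b, c} ∧ a ≠ b ∧ a ≠ c ∧ b ≠ c := by
  obtain ⟨a, b, c, h1, h2, h3, h4⟩ := Finset.card_eq_three.1 hf.2
  exact ⟨a, b, c, h4, h1, h2, h3⟩

theorem cross_ne_zero_of_mem {K : SimplicialComplex ℝ Plane} {a b c : Plane}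
    (hf : ({a, b, c} : Finset Plane) ∈ triangles K) : cross a b c ≠ 0 := by
  apply cross_ne_zero
  have hcard := hf.2
  have hab : a ≠ b := by
    rintro rfl
    have : ({a, a, c} : Finset Plane).card ≤ 2 := by simpa using Finset.card_le_two
    omega
  have hac : a ≠ c := by
    rintro rfl
    have : ({a, b, a} : Finset Plane).card ≤ 2 := by
      rw [Finset.insert_eq_of_mem (by simp)]; exact Finset.card_le_two
    omega
  have hbc : b ≠ c := by
    rintro rfl
    have : ({a, b, b} : Finset Plane).card ≤ 2 := by simpa using Finset.card_le_two
    omega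
  have hi := K.indep hf.1
  let e : Fin 3 ↪ ({a, b, c} : Finset Plane) :=
    ⟨![⟨a, by simp⟩, ⟨b, by simp⟩, ⟨c, by simp⟩], by
      intro i j hij
      fin_cases i <;> fin_cases j <;> simp_all⟩
  have he : (fun i => ((e i : ({a, b, c} : Finset Plane)) : Plane)) = ![a, b, c] := by
    funext i
    fin_cases i <;> rfl
  have := hi.comp_embedding e
  rw [← he]
  exact this

/-- Two triangles that share an edge lie on opposite sides of it. -/
theorem cross_mul_cross_neg {K : SimplicialComplex ℝ Plane} {a b c d : Plane}
    (hf : ({a, b, c} : Finset Plane) ∈ triangles K)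
    (hf' : ({a, b, d} : Finset Plane) ∈ triangles K) (hcd : c ≠ d) :
    cross a b c * cross a b d < 0 := by
  have hc := cross_ne_zero_of_mem hf
  have hd := cross_ne_zero_of_mem hf'
  by_contra! hcon
  have hcon : 0 < cross a b c * cross a b d := lt_of_le_of_ne hcon (mul_ne_zero hc hd).symm
  -- If `c` and `d` were on the same side, the midpoint of the edge moved slightly towards `c` would
  -- lie in both triangles. Their intersection is contained in the segment `a b`, where `cross a b`
  -- vanishes.
  set x : Plane := (1 / 2 : ℝ) • a + (1 / 2 : ℝ) • b with hxdef
  have hx : x ∈ openSegment ℝ a b := ⟨1 / 2, 1 / 2, by norm_num, by norm_num, by norm_num, rfl⟩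
  have hx0 := cross_eq_zero_of_mem_segment (openSegment_subset_segment ℝ a b hx)
  have hlim : Tendsto (fun t : ℝ => (1 - t) • x + t • c) (𝓝[>] 0) (𝓝 x) := by
    have : Continuous fun t : ℝ => (1 - t) • x + t • c := by fun_prop
    have := this.tendsto 0
    simp only [sub_zero, one_smul, zero_smul, add_zero] at this
    exact this.mono_left nhdsWithin_le_nhds
  obtain ⟨t, ⟨h1, h2⟩, ht⟩ := ((hlim.eventually ((eventually_mem_triangle hc hx).and
    (eventually_mem_triangle hd hx))).and self_mem_nhdsWithin).exists
  have ht : 0 < t := ht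
  have hcr : cross a b ((1 - t) • x + t • c) = t * cross a b c := by
    rw [cross_combination _ _ _ _ _ _ (by ring), hx0]; ring
  have m1 := h1.1 (by rw [hcr, mul_div_assoc, div_self hc]; linarith)
  have m2 := h2.1 (by
    rw [hcr, mul_div_assoc]
    refine mul_nonneg ht.le ?_
    -- Writing the inverse as its square times `cross a b d` exposes the product in `hcon`.
    rw [div_eq_mul_inv, ← mul_self_mul_inv (cross a b d)⁻¹]
    rw [inv_inv]
    nlinarith [mul_self_nonneg (cross a b d)⁻¹, hcon])
  have hm := K.inter_subset_convexHull hf.1 hf'.1 ⟨by simpa using m1, by simpa using m2⟩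
  have hca : c ≠ a := by rintro rfl; exact hc (cross_left _ _)
  have hcb : c ≠ b := by rintro rfl; exact hc (cross_right _ _)
  have hsub : (({a, b, c} : Finset Plane) : Set Plane) ∩ ({a, b, d} : Finset Plane) ⊆ {a, b} := by
    rintro z ⟨hz1, hz2⟩
    simp only [Finset.coe_insert, Finset.coe_singleton, Set.mem_insert_iff,
      Set.mem_singleton_iff] at hz1 hz2 ⊢
    rcases hz1 with h | h | h
    · exact Or.inl h
    · exact Or.inr h
    · subst h
      rcases hz2 with h | h | h
      · exact Or.inl h
      · exact Or.inr h
      · exact absurd h hcd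
  have hm := convexHull_mono hsub hm
  rw [convexHull_pair] at hm
  have := cross_eq_zero_of_mem_segment hm
  rw [hcr] at this
  exact (mul_ne_zero ht.ne' hc) this

/-! ### A radial bump and its derivatives over half-planes. -/

/-- A smooth radially decreasing function supported in the unit disc. -/
def bump (z : Plane) : ℝ := expNegInvGlue (1 - ‖z‖ ^ 2)

theorem contDiff_bump : ContDiff ℝ ∞ bump :=
  (expNegInvGlue.contDiff (n := ⊤)).comp (contDiff_const.sub (contDiff_norm_sq ℝ))

theorem bump_eq_zero {z : Plane} (hz : 1 ≤ ‖z‖) : bump z = 0 :=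
  expNegInvGlue.zero_of_nonpos (by nlinarith)

theorem tsupport_bump_subset : tsupport bump ⊆ Metric.closedBall 0 1 := by
  refine closure_minimal (fun z hz => ?_) Metric.isClosed_closedBall
  by_contra h
  rw [mem_closedBall_zero_iff, not_le] at h
  exact hz (bump_eq_zero h.le)

theorem hasCompactSupport_bump : HasCompactSupport bump :=
  (isCompact_closedBall 0 1).of_isClosed_subset (isClosed_tsupport _) tsupport_bump_subset

theorem hasDerivAt_expNegInvGlue (t : ℝ) :
    HasDerivAt expNegInvGlue (t⁻¹ ^ 2 * expNegInvGlue t) t := by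
  simpa using expNegInvGlue.hasDerivAt_polynomial_eval_inv_mul 1 t

/-- The explicit form shows the sign: inside the unit disc it is opposite to that of `inner ℝ z u`.
-/
theorem fderiv_bump (z u : Plane) : fderiv ℝ bump z u =
    -(2 * inner ℝ z u) * ((1 - ‖z‖ ^ 2)⁻¹ ^ 2 * expNegInvGlue (1 - ‖z‖ ^ 2)) := by
  have h1 : HasFDerivAt (fun z : Plane => 1 - ‖z‖ ^ 2) (-(2 • innerSL ℝ z)) z :=
    (HasStrictFDerivAt.hasFDerivAt (hasStrictFDerivAt_norm_sq z)).const_sub 1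
  have h2 := (hasDerivAt_expNegInvGlue (1 - ‖z‖ ^ 2)).comp_hasFDerivAt z h1
  have h3 : HasFDerivAt bump _ z := h2
  rw [h3.fderiv]
  simp
  ring

theorem continuous_fderiv_bump (u : Plane) : Continuous fun z => fderiv ℝ bump z u :=
  (contDiff_bump.continuous_fderiv (by simp)).clm_apply continuous_const

theorem integrable_fderiv_bump (u : Plane) : Integrable fun z => fderiv ℝ bump z u :=
  (continuous_fderiv_bump u).integrable_of_hasCompactSupport
    (hasCompactSupport_bump.fderiv_apply ℝ u)

theorem isOpen_halfPlane (N : Plane) : IsOpen {z : Plane | 0 < inner ℝ N z} :=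
  isOpen_lt continuous_const (by fun_prop)

/-- The indicator of the half-plane is constant along `u`, hence has line derivative zero, and
integration by parts moves the derivative onto it. -/
theorem integral_halfPlane_fderiv_bump_of_inner_eq_zero {N u : Plane} (h : inner ℝ N u = 0) :
    ∫ z in {z : Plane | 0 < inner ℝ N z}, fderiv ℝ bump z u = 0 := by
  set H := {z : Plane | 0 < inner ℝ N z}
  have hH : MeasurableSet H := (isOpen_halfPlane N).measurableSet
  have key := integral_bilinear_hasLineDerivAt_right_eq_neg_left_of_integrable (E := Plane)
    (μ := volume) (v := u) (B := ContinuousLinearMap.mul ℝ ℝ) (f := H.indicator 1) (f' := 0)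
    (g := bump) (g' := fun z => fderiv ℝ bump z u) (by simp)
    (by
      refine ((integrable_fderiv_bump u).indicator hH).congr (Eventually.of_forall fun z => ?_)
      by_cases hz : z ∈ H <;> simp [hz])
    (by
      refine ((contDiff_bump.continuous.integrable_of_hasCompactSupport
        hasCompactSupport_bump).indicator hH).congr (Eventually.of_forall fun z => ?_)
      by_cases hz : z ∈ H <;> simp [hz])
    (by
      intro x _
      have : (fun t : ℝ => H.indicator (1 : Plane → ℝ) (x + t • u)) =
          fun _ => H.indicator (1 : Plane → ℝ) x := by
        funext t
        have : x + t • u ∈ H ↔ x ∈ H := by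
          simp [H, inner_add_right, inner_smul_right, h]
        simp [Set.indicator, this]
      simp only [HasLineDerivAt, this]
      exact hasDerivAt_const _ _)
    (by
      intro x _
      exact ((contDiff_bump.differentiable (by simp)) x).hasFDerivAt.hasLineDerivAt u)
  rw [← integral_indicator hH]
  simp only [Pi.zero_apply, map_zero, zero_apply, integral_zero,
    neg_zero] at key
  rw [← key]
  congr 1
  funext z
  by_cases hz : z ∈ H <;> simp [hz]

theorem integral_halfPlane_fderiv_bump_neg {N : Plane} (hN : N ≠ 0) :
    ∫ z in {z : Plane | 0 < inner ℝ N z}, fderiv ℝ bump z N < 0 := by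
  set H := {z : Plane | 0 < inner ℝ N z} with hHdef
  have hHo : IsOpen H := isOpen_halfPlane N
  rw [← neg_pos, ← integral_neg, setIntegral_pos_iff_support_of_nonneg_ae]
  · have hsub : H ∩ Metric.ball 0 1 ⊆ (Function.support fun z => -fderiv ℝ bump z N) ∩ H := by
      rintro z ⟨hz, hz1⟩
      refine ⟨?_, hz⟩
      have h1 : 0 < 1 - ‖z‖ ^ 2 := by
        rw [mem_ball_zero_iff] at hz1
        nlinarith [norm_nonneg z]
      have h2 : 0 < inner ℝ z N := by rw [real_inner_comm]; exact hz
      have h3 := expNegInvGlue.pos_of_pos h1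
      rw [Function.mem_support, fderiv_bump]
      have : 0 < (1 - ‖z‖ ^ 2)⁻¹ := inv_pos.2 h1
      apply ne_of_gt
      have := mul_pos (mul_pos two_pos h2) (mul_pos (pow_pos this 2) h3)
      linarith
    refine lt_of_lt_of_le ?_ (measure_mono hsub)
    -- The multiple of `N` of norm `1 / 2` shows that the open half-disc is nonempty.
    refine (hHo.inter Metric.isOpen_ball).measure_pos _ ⟨(2 * ‖N‖)⁻¹ • N, ?_, ?_⟩
    · have := norm_pos_iff.2 hN
      simp only [hHdef, Set.mem_ofPred_eq, inner_smul_right, real_inner_self_eq_norm_sq]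
      positivity
    · have := norm_pos_iff.2 hN
      rw [mem_ball_zero_iff, norm_smul, norm_inv, norm_mul, norm_norm]
      simp only [Real.norm_ofNat]
      field_simp
      norm_num
  · rw [EventuallyLE, ae_restrict_iff' hHo.measurableSet]
    refine Eventually.of_forall fun z hz => ?_
    have h2 : 0 < inner ℝ z N := by rw [real_inner_comm]; exact hz
    have h3 := expNegInvGlue.nonneg (1 - ‖z‖ ^ 2)
    rw [fderiv_bump]
    simp only [Pi.zero_apply]
    have := mul_nonneg (mul_nonneg zero_le_two h2.le)
      (mul_nonneg (sq_nonneg (1 - ‖z‖ ^ 2)⁻¹) h3)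
    linarith
  · exact (integrable_fderiv_bump N).neg.integrableOn

/-- The part of `r` orthogonal to `N` contributes nothing, and the part along `N` contributes its
coefficient times a negative number. -/
theorem inner_eq_zero_of_integral_halfPlane {N r : Plane} (hN : N ≠ 0)
    (h : ∫ z in {z : Plane | 0 < inner ℝ N z}, fderiv ℝ bump z r = 0) : inner ℝ N r = 0 := by
  have hN2 : (‖N‖ ^ 2 : ℝ) ≠ 0 := pow_ne_zero _ (norm_ne_zero_iff.2 hN)
  set t : ℝ := inner ℝ N r / ‖N‖ ^ 2 with ht
  have hu : inner ℝ N (r - t • N) = 0 := by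
    rw [inner_sub_right, inner_smul_right, real_inner_self_eq_norm_sq, ht]
    field_simp
    ring
  have h1 := integral_halfPlane_fderiv_bump_of_inner_eq_zero hu
  simp only [map_sub, map_smul] at h1
  have hi : IntegrableOn (fun z => t • fderiv ℝ bump z N) {z : Plane | 0 < inner ℝ N z} :=
    ((integrable_fderiv_bump N).smul t).integrableOn
  rw [integral_sub (integrable_fderiv_bump r).integrableOn hi, h, integral_smul, zero_sub, neg_eq_zero,
    smul_eq_mul] at h1
  have h2 := (mul_eq_zero.1 h1).resolve_right (integral_halfPlane_fderiv_bump_neg hN).ne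
  rw [ht, div_eq_zero_iff] at h2
  exact h2.resolve_right hN2

theorem integral_fderiv_bump (u : Plane) : ∫ z, fderiv ℝ bump z u = 0 := by
  have := integral_bilinear_hasLineDerivAt_right_eq_neg_left_of_integrable (E := Plane)
    (μ := volume) (v := u) (B := ContinuousLinearMap.mul ℝ ℝ) (f := fun _ => 1) (f' := 0)
    (g := bump) (g' := fun z => fderiv ℝ bump z u) (by simp)
    (by simpa using integrable_fderiv_bump u)
    (by
      simpa using (contDiff_bump.continuous.integrable_of_hasCompactSupport
        hasCompactSupport_bump : Integrable bump volume))
    (fun x _ => hasDerivAt_const (𝕜 := ℝ) (0 : ℝ) (1 : ℝ))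
    (fun x _ => ((contDiff_bump.differentiable (by simp)) x).hasFDerivAt.hasLineDerivAt u)
  simpa using this

/-! ### Blow-up at a point of an edge: no jump of the normal component. -/

/-- The bump function scaled to the disc of radius `ε` about `x`. -/
def scaledBump (x : Plane) (ε : ℝ) (y : Plane) : ℝ := bump (ε⁻¹ • (y - x))

theorem scaledBump_eq_zero {x y : Plane} {ε : ℝ} (hε : 0 < ε) (hy : y ∉ Metric.ball x ε) :
    scaledBump x ε y = 0 := by
  rw [mem_ball_iff_norm, not_lt] at hy
  apply bump_eq_zero
  rw [norm_smul, norm_inv, Real.norm_of_nonneg hε.le, ← div_eq_inv_mul]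
  exact (one_le_div hε).2 hy

theorem isTestFunction_scaledBump {x : Plane} {ε δ : ℝ} (hε : 0 < ε) (hεδ : ε < δ) {Ω : Set Plane}
    (hΩ : Metric.ball x δ ⊆ Ω) : IsTestFunction Ω (scaledBump x ε) := by
  have hs : tsupport (scaledBump x ε) ⊆ Metric.closedBall x ε := by
    refine closure_minimal (fun y hy => ?_) Metric.isClosed_closedBall
    by_contra h
    exact hy (scaledBump_eq_zero hε fun h' => h (Metric.ball_subset_closedBall h'))
  exact ⟨contDiff_bump.comp (by fun_prop : ContDiff ℝ ∞ fun y : Plane => ε⁻¹ • (y - x)),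
    (isCompact_closedBall x ε).of_isClosed_subset (isClosed_tsupport _) hs,
    hs.trans ((Metric.closedBall_subset_ball hεδ).trans hΩ)⟩

theorem fderiv_scaledBump (x : Plane) (ε : ℝ) (y u : Plane) :
    fderiv ℝ (scaledBump x ε) y u = ε⁻¹ * fderiv ℝ bump (ε⁻¹ • (y - x)) u := by
  have h1 : HasFDerivAt (fun y : Plane => ε⁻¹ • (y - x))
      (ε⁻¹ • ContinuousLinearMap.id ℝ Plane) y :=
    ((hasFDerivAt_id y).sub_const x).const_smul ε⁻¹
  have h2 := ((contDiff_bump.differentiable (by simp)) (ε⁻¹ • (y - x))).hasFDerivAt.comp y h1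
  have h3 : HasFDerivAt (scaledBump x ε) _ y := h2
  rw [h3.fderiv]
  simp

theorem integral_comp_scale (x : Plane) {ε : ℝ} (hε : 0 < ε) (F : Plane → ℝ) :
    ∫ y, F y = ε ^ 2 * ∫ z, F (x + ε • z) := by
  rw [Measure.integral_comp_smul volume (fun z => F (x + z)) ε, integral_add_left_eq_self]
  simp only [finrank_euclideanSpace, Fintype.card_fin, smul_eq_mul]
  rw [abs_of_pos (by positivity), ← mul_assoc, mul_inv_cancel₀ (by positivity), one_mul]

theorem volume_inner_sub_eq_zero {N x : Plane} (hN : N ≠ 0) :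
    volume {y : Plane | inner ℝ N (y - x) = 0} = 0 := by
  have h := Measure.addHaar_affineSubspace (volume : Measure Plane)
    (AffineSubspace.mk' x (LinearMap.ker (innerSL ℝ N).toLinearMap)) (by
      intro h
      have : x + N ∈ AffineSubspace.mk' x (LinearMap.ker (innerSL ℝ N).toLinearMap) := by
        rw [h]; trivial
      rw [AffineSubspace.mem_mk'] at this
      simp at this
      exact hN this)
  convert h using 2
  ext y
  simp [AffineSubspace.mem_mk']

/-- A square-integrable function tested against scaled bumps is `o(ε)`. -/
theorem tendsto_integral_mul_scaledBump {Ω : Set Plane} {w : Plane → ℝ}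
    (hw : MemLp w 2 (volume.restrict Ω)) (x : Plane) :
    Tendsto (fun ε : ℝ => ε⁻¹ * ∫ y in Ω, w y * scaledBump x ε y) (𝓝[>] 0) (𝓝 0) := by
  have hwi : Integrable (fun y => w y ^ 2) (volume.restrict Ω) := hw.integrable_sq
  -- By Cauchy–Schwarz the integral is at most `ε * √(A ε) * √C`, since scaling in the plane
  -- multiplies the L² norm of the bump by `ε`. The factor `A ε` tends to zero because the balls
  -- shrink to a null set.
  set A : ℝ → ℝ := fun ε => ∫ y in Ω, (Metric.ball x ε).indicator (fun y => w y ^ 2) y with hA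
  set C : ℝ := ∫ z, bump z ^ 2 with hC
  have hA0 : Tendsto A (𝓝[>] 0) (𝓝 0) := by
    have : Tendsto A (𝓝[>] 0) (𝓝 (∫ _y in Ω, (0 : ℝ))) := by
      refine tendsto_integral_filter_of_dominated_convergence (fun y => w y ^ 2) ?_ ?_ hwi ?_
      · exact Eventually.of_forall fun ε =>
          hwi.aestronglyMeasurable.indicator Metric.isOpen_ball.measurableSet
      · refine Eventually.of_forall fun ε => Eventually.of_forall fun y => ?_
        refine (norm_indicator_le_norm_self _ _).trans ?_
        rw [Real.norm_of_nonneg (sq_nonneg _)]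
      · have : ∀ᵐ y ∂(volume.restrict Ω), y ≠ x :=
          ae_restrict_of_ae (Measure.ae_ne volume x)
        filter_upwards [this] with y hy
        refine tendsto_const_nhds.congr' ?_
        have : ∀ᶠ ε : ℝ in 𝓝[>] 0, ε < dist y x :=
          nhdsWithin_le_nhds (gt_mem_nhds (dist_pos.2 hy))
        filter_upwards [this] with ε hε
        rw [Set.indicator_of_notMem]
        simpa using hε.le
    simpa using this
  have hbound : ∀ ε : ℝ, 0 < ε →
      |ε⁻¹ * ∫ y in Ω, w y * scaledBump x ε y| ≤ √(A ε) * √C := by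
    intro ε hε
    have hφ := (isTestFunction_scaledBump (x := x) hε (lt_add_one ε) (Set.subset_univ _))
    have hφL : MemLp (scaledBump x ε) 2 (volume.restrict Ω) := by
      have := hφ.memLp
      rw [Measure.restrict_univ] at this
      exact this.restrict Ω
    have h1 : ∫ y in Ω, w y * scaledBump x ε y =
        ∫ y in Ω, (Metric.ball x ε).indicator w y * scaledBump x ε y := by
      congr 1
      funext y
      by_cases hy : y ∈ Metric.ball x ε
      · rw [Set.indicator_of_mem hy]
      · rw [scaledBump_eq_zero hε hy]; simp
    have hf : MemLp ((Metric.ball x ε).indicator w) 2 (volume.restrict Ω) :=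
      hw.indicator Metric.isOpen_ball.measurableSet
    have h2 : |∫ y in Ω, (Metric.ball x ε).indicator w y * scaledBump x ε y| ≤
        √(A ε) * √(∫ y in Ω, scaledBump x ε y ^ 2) := by
      refine (abs_integral_le_integral_abs).trans ?_
      have := integral_mul_le_Lp_mul_Lq_of_nonneg (p := 2) (q := 2)
        (Real.HolderConjugate.two_two) (μ := volume.restrict Ω)
        (f := fun y => |(Metric.ball x ε).indicator w y|) (g := fun y => |scaledBump x ε y|)
        (Eventually.of_forall fun _ => abs_nonneg _) (Eventually.of_forall fun _ => abs_nonneg _)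
        (by simpa using hf.norm) (by simpa using hφL.norm)
      simp only [Real.rpow_ofNat, sq_abs, ← Real.sqrt_eq_rpow] at this
      have e : A ε = ∫ y in Ω, (Metric.ball x ε).indicator w y ^ 2 := by
        simp only [hA]
        congr 1
        funext y
        by_cases hy : y ∈ Metric.ball x ε <;> simp [hy]
      rw [e]
      simpa only [abs_mul] using this
    have h3 : ∫ y in Ω, scaledBump x ε y ^ 2 ≤ ε ^ 2 * C := by
      refine (setIntegral_le_integral ?_ (Eventually.of_forall fun _ => sq_nonneg _)).trans ?_
      · have := hφ.memLp
        rw [Measure.restrict_univ] at this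
        exact this.integrable_sq
      · rw [integral_comp_scale x hε]
        simp [scaledBump, smul_smul, inv_mul_cancel₀ hε.ne', hC]
    rw [abs_mul, abs_of_pos (inv_pos.2 hε), h1, inv_mul_le_iff₀ hε]
    refine h2.trans ?_
    calc √(A ε) * √(∫ y in Ω, scaledBump x ε y ^ 2) ≤ √(A ε) * √(ε ^ 2 * C) := by
          gcongr
      _ = ε * (√(A ε) * √C) := by
          rw [Real.sqrt_mul (sq_nonneg ε), Real.sqrt_sq hε.le]; ring
  rw [tendsto_zero_iff_abs_tendsto_zero]
  refine squeeze_zero' (Eventually.of_forall fun _ => abs_nonneg _)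
    (g := fun ε => √(A ε) * √C) ?_ ?_
  · filter_upwards [self_mem_nhdsWithin] with ε hε using hbound ε hε
  · simpa using (hA0.sqrt.mul_const √C)

/-- If a field with square-integrable weak divergence is continuous up to a line from both sides,
then its normal component does not jump across that line. -/
theorem inner_eq_of_weakDiv {Ω : Set Plane} {x : Plane} {δ : ℝ} (hδ : 0 < δ)
    (hΩ : Metric.ball x δ ⊆ Ω) {v : Plane → Plane} {w : Plane → ℝ}
    (hw : MemLp w 2 (volume.restrict Ω))
    (hv : ∀ φ : Plane → ℝ, IsTestFunction Ω φ →
      ∫ y in Ω, fderiv ℝ φ y (v y) = -∫ y in Ω, w y * φ y)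
    {q q' : Plane → Plane} (hq : Continuous q) (hq' : Continuous q') {N : Plane} (hN : N ≠ 0)
    (h1 : ∀ᵐ y ∂(volume.restrict Ω), y ∈ Metric.ball x δ → inner ℝ N (y - x) < 0 → v y = q y)
    (h2 : ∀ᵐ y ∂(volume.restrict Ω), y ∈ Metric.ball x δ → 0 < inner ℝ N (y - x) → v y = q' y) :
    inner ℝ N (q x) = inner ℝ N (q' x) := by
  set H := {z : Plane | 0 < inner ℝ N z} with hHdef
  have hH : MeasurableSet H := (isOpen_halfPlane N).measurableSet
  -- `P ε` is `v` seen at scale `ε` around `x`, up to a null set on the part that the bump sees. The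
  -- line itself is null, so its assignment to `q` is harmless.
  set P : ℝ → Plane → Plane := fun ε =>
    H.piecewise (fun z => q' (x + ε • z)) (fun z => q (x + ε • z)) with hP
  set J : ℝ → ℝ := fun ε => ∫ z, fderiv ℝ bump z (P ε z) with hJ
  have hnull : ∀ᵐ y ∂(volume.restrict Ω), inner ℝ N (y - x) ≠ 0 := by
    refine ae_restrict_of_ae ?_
    rw [ae_iff]
    simpa using volume_inner_sub_eq_zero (x := x) hN
  -- Substituting `y = x + ε • z` gives the Jacobian `ε ^ 2`, and differentiating the scaled bump
  -- gives `ε⁻¹`. The left side of the weak identity is therefore `ε * J ε`.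
  have hJε : ∀ ε : ℝ, 0 < ε → ε < δ → J ε = -(ε⁻¹ * ∫ y in Ω, w y * scaledBump x ε y) := by
    intro ε hε hεδ
    have hφ := isTestFunction_scaledBump hε hεδ hΩ
    have e1 : ∫ y in Ω, fderiv ℝ (scaledBump x ε) y (v y) =
        ∫ y in Ω, fderiv ℝ (scaledBump x ε) y (P ε (ε⁻¹ • (y - x))) := by
      refine integral_congr_ae ?_
      filter_upwards [h1, h2, hnull] with y hy1 hy2 hy0
      by_cases hy : y ∈ Metric.ball x δ
      · congr 1
        have hback : x + ε • ε⁻¹ • (y - x) = y := by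
          rw [smul_smul, mul_inv_cancel₀ hε.ne', one_smul]; abel
        have hiff : ε⁻¹ • (y - x) ∈ H ↔ 0 < inner ℝ N (y - x) := by
          simp only [hHdef, Set.mem_ofPred_eq, inner_smul_right]
          exact mul_pos_iff_of_pos_left (inv_pos.2 hε)
        rcases lt_or_gt_of_ne hy0 with h | h
        · rw [hy1 hy h, hP]
          simp only
          rw [Set.piecewise_eq_of_notMem _ _ _ (by rw [hiff]; exact h.not_gt), hback]
        · rw [hy2 hy h, hP]
          simp only
          rw [Set.piecewise_eq_of_mem _ _ _ (by rw [hiff]; exact h), hback]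
      · have hnot : y ∉ tsupport (fderiv ℝ (scaledBump x ε)) := fun h =>
          hy ((isTestFunction_scaledBump hε hεδ (le_refl (Metric.ball x δ))).support
            (tsupport_fderiv_subset ℝ h))
        rw [image_eq_zero_of_notMem_tsupport hnot]
        simp
    have e2 : ∫ y in Ω, fderiv ℝ (scaledBump x ε) y (P ε (ε⁻¹ • (y - x))) =
        ∫ y, fderiv ℝ (scaledBump x ε) y (P ε (ε⁻¹ • (y - x))) := by
      refine setIntegral_eq_integral_of_forall_compl_eq_zero fun y hy => ?_
      have hnot : y ∉ tsupport (fderiv ℝ (scaledBump x ε)) := fun h =>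
        hy (hφ.support (tsupport_fderiv_subset ℝ h))
      rw [image_eq_zero_of_notMem_tsupport hnot]
      simp
    have e3 : ∫ y, fderiv ℝ (scaledBump x ε) y (P ε (ε⁻¹ • (y - x))) = ε * J ε := by
      rw [integral_comp_scale x hε, hJ]
      simp only [fderiv_scaledBump, add_sub_cancel_left, smul_smul, inv_mul_cancel₀ hε.ne',
        one_smul, integral_const_mul]
      field_simp
    have := hv _ hφ
    rw [e1, e2, e3] at this
    rw [← mul_neg, ← this, ← mul_assoc, inv_mul_cancel₀ hε.ne', one_mul]
  have hJ0 : Tendsto J (𝓝[>] 0) (𝓝 0) := by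
    have := (tendsto_integral_mul_scaledBump hw x).neg
    rw [neg_zero] at this
    refine this.congr' ?_
    filter_upwards [self_mem_nhdsWithin, nhdsWithin_le_nhds (gt_mem_nhds hδ)] with ε h1 h2
    exact (hJε ε h1 h2).symm
  have hJlim : Tendsto J (𝓝[>] 0) (𝓝 (J 0)) := by
    -- For `ε < 1` and `z` in the unit disc the point `x + ε • z` stays in this ball, which gives a
    -- dominating function.
    obtain ⟨C, hC⟩ := (isCompact_closedBall x 1).exists_bound_of_continuousOn hq.continuousOn
    obtain ⟨C', hC'⟩ := (isCompact_closedBall x 1).exists_bound_of_continuousOn hq'.continuousOn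
    have hbi : Integrable fun z => ‖fderiv ℝ bump z‖ * max C C' :=
      (((contDiff_bump.continuous_fderiv (by simp)).norm.integrable_of_hasCompactSupport
        (hasCompactSupport_bump.fderiv ℝ).norm)).mul_const _
    refine tendsto_integral_filter_of_dominated_convergence _ ?_ ?_ hbi ?_
    · refine Eventually.of_forall fun ε => ?_
      refine isBoundedBilinearMap_apply.continuous.comp_aestronglyMeasurable
        ((contDiff_bump.continuous_fderiv (by simp)).aestronglyMeasurable.prodMk ?_)
      exact (StronglyMeasurable.piecewise hH
        (hq'.comp (by fun_prop)).stronglyMeasurable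
        (hq.comp (by fun_prop)).stronglyMeasurable).aestronglyMeasurable
    · filter_upwards [self_mem_nhdsWithin, nhdsWithin_le_nhds (gt_mem_nhds one_pos)] with ε h0 h1
      have h0 : 0 < ε := h0
      refine Eventually.of_forall fun z => ?_
      by_cases hz : z ∈ Metric.closedBall (0 : Plane) 1
      · refine ((fderiv ℝ bump z).le_opNorm _).trans ?_
        gcongr
        have hmem : x + ε • z ∈ Metric.closedBall x 1 := by
          rw [mem_closedBall_iff_norm, add_sub_cancel_left, norm_smul, Real.norm_of_nonneg h0.le]
          rw [mem_closedBall_zero_iff] at hz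
          nlinarith [norm_nonneg z]
        by_cases hzH : z ∈ H
        · rw [hP]
          simp only
          rw [Set.piecewise_eq_of_mem _ _ _ hzH]
          exact (hC' _ hmem).trans (le_max_right _ _)
        · rw [hP]
          simp only
          rw [Set.piecewise_eq_of_notMem _ _ _ hzH]
          exact (hC _ hmem).trans (le_max_left _ _)
      · have hnot : z ∉ tsupport (fderiv ℝ bump) := fun h =>
          hz (tsupport_bump_subset (tsupport_fderiv_subset ℝ h))
        rw [image_eq_zero_of_notMem_tsupport hnot]
        simp
    · refine Eventually.of_forall fun z => ((fderiv ℝ bump z).continuous.tendsto _).comp ?_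
      have hlim : ∀ p : Plane → Plane, Continuous p →
          Tendsto (fun ε : ℝ => p (x + ε • z)) (𝓝[>] 0) (𝓝 (p (x + (0 : ℝ) • z))) := fun p hp =>
        ((hp.comp (by fun_prop : Continuous fun ε : ℝ => x + ε • z)).tendsto 0).mono_left
          nhdsWithin_le_nhds
      by_cases hzH : z ∈ H
      · simpa [hP, hzH] using hlim q' hq'
      · simpa [hP, hzH] using hlim q hq
  have hJ00 : J 0 = 0 := tendsto_nhds_unique hJlim hJ0
  -- Derivatives of the bump have integral zero over the plane, so the constant `q x` may be
  -- subtracted on both sides and only the jump over `H` remains.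
  have hsplit : J 0 = ∫ z in H, fderiv ℝ bump z (q' x - q x) := by
    have : ∀ z, fderiv ℝ bump z (P 0 z) =
        H.indicator (fun z => fderiv ℝ bump z (q' x - q x)) z + fderiv ℝ bump z (q x) := by
      intro z
      by_cases hz : z ∈ H <;> simp [hP, hz]
    rw [hJ]
    simp only [this]
    rw [integral_add ((integrable_fderiv_bump _).indicator hH) (integrable_fderiv_bump _),
      integral_fderiv_bump, add_zero, integral_indicator hH]
  have := inner_eq_zero_of_integral_halfPlane hN (hsplit.symm.trans hJ00)
  rw [inner_sub_right, sub_eq_zero] at this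
  exact this.symm

/-! ### Lagrange fields belong to the Stenberg space. -/

/-- Close to `x` only pieces that contain `x` occur, because the others are finitely many closed
sets missing `x`. This bounds `‖h z - h x‖` by `C * ‖z - x‖` locally, and a mean value inequality
along segments makes the bound global with the same constant. -/
theorem lipschitzWith_of_finite_closed_cover {E ι : Type*} [NormedAddCommGroup E]
    [NormedSpace ℝ E] [Finite ι] {S : ι → Set E} (hS : ∀ i, IsClosed (S i))
    (hcov : ∀ x, ∃ i, x ∈ S i) {C : ℝ≥0} {h : E → ℝ} (hL : ∀ i, LipschitzOnWith C h (S i)) :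
    LipschitzWith C h := by
  have hloc : ∀ x, ∀ᶠ z in 𝓝 x, ‖h z - h x‖ ≤ C * ‖z - x‖ := by
    intro x
    have : ∀ᶠ z in 𝓝 x, ∀ i, z ∈ S i → x ∈ S i := by
      rw [eventually_all]
      intro i
      by_cases hx : x ∈ S i
      · exact Eventually.of_forall fun _ _ => hx
      · filter_upwards [(hS i).isOpen_compl.mem_nhds hx] with z hz hz' using absurd hz' hz
    filter_upwards [this] with z hz
    obtain ⟨i, hi⟩ := hcov z
    simpa [dist_eq_norm] using (hL i).dist_le_mul z hi x (hz i hi)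
  have hcont : Continuous h := by
    rw [continuous_iff_continuousAt]
    intro x
    rw [ContinuousAt, tendsto_iff_norm_sub_tendsto_zero]
    refine squeeze_zero' (Eventually.of_forall fun _ => norm_nonneg _) (hloc x) ?_
    have : Continuous fun z => (C : ℝ) * ‖z - x‖ := by fun_prop
    simpa using this.tendsto x
  refine LipschitzWith.of_dist_le_mul fun y x => ?_
  rw [dist_eq_norm, dist_eq_norm]
  refine le_of_forall_pos_le_add fun η hη => ?_
  set γ : ℝ → E := fun t => x + t • (y - x) with hγ
  have hγc : Continuous γ := by fun_prop
  have hγs : ∀ s t, γ s - γ t = (s - t) • (y - x) := fun s t => by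
    simp only [hγ, sub_smul]; abel
  -- The comparison function needs a strictly larger slope; the extra `η` supplies it.
  have key := image_norm_le_of_liminf_right_slope_norm_lt_deriv_boundary (a := 0) (b := 1)
    (f := fun t => h (γ t) - h x) (f' := fun _ => C * ‖y - x‖)
    ((hcont.comp hγc).sub continuous_const).continuousOn
    (by
      intro t _ r hr
      refine Eventually.frequently ?_
      have h1 : ∀ᶠ z in 𝓝[>] t, ‖h (γ z) - h (γ t)‖ ≤ C * ‖γ z - γ t‖ :=
        ((hγc.tendsto t).mono_left nhdsWithin_le_nhds).eventually (hloc (γ t))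
      filter_upwards [h1, self_mem_nhdsWithin] with z hz hzt
      have hzt : 0 < z - t := sub_pos.2 hzt
      refine lt_of_le_of_lt ?_ hr
      rw [slope_def_field, div_le_iff₀ hzt]
      simp only [Function.comp]
      rw [hγs, norm_smul, Real.norm_of_nonneg hzt.le] at hz
      have := norm_sub_norm_le (h (γ z) - h x) (h (γ t) - h x)
      rw [sub_sub_sub_cancel_right] at this
      linarith)
    (B := fun t => (C * ‖y - x‖ + η) * t) (B' := fun _ => C * ‖y - x‖ + η)
    (by simp [hγ]) (by fun_prop)
    (fun t _ => by simpa using ((hasDerivAt_id t).const_mul (C * ‖y - x‖ + η)).hasDerivWithinAt)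
    (fun _ _ _ => by linarith)
  simpa [hγ] using key (Set.right_mem_Icc.2 zero_le_one)

theorem contDiff_eval (q : MvPolynomial (Fin 2) ℝ) :
    ContDiff ℝ ∞ fun x : Plane => MvPolynomial.eval x.ofLp q := by
  induction q using MvPolynomial.induction_on with
  | C a => simpa using contDiff_const
  | add p q hp hq => simpa using hp.add hq
  | mul_X p i hp => simpa using hp.mul (by fun_prop : ContDiff ℝ ∞ fun x : Plane => x.ofLp i)

theorem contDiff_polyField (q : Fin 2 → MvPolynomial (Fin 2) ℝ) : ContDiff ℝ ∞ (polyField q) := by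
  rw [contDiff_euclidean]
  exact fun i => contDiff_eval (q i)

theorem isCompact_triangle (f : Finset Plane) : IsCompact (convexHull ℝ (f : Set Plane)) :=
  f.finite_toSet.isCompact_convexHull (𝕜 := ℝ)

theorem IsTriangulation.finite_triangles {K : SimplicialComplex ℝ Plane} (hK : IsTriangulation K) :
    (triangles K).Finite := hK.finite.subset fun _ hf => hf.1

theorem IsTriangulation.exists_triangle {K : SimplicialComplex ℝ Plane} (hK : IsTriangulation K)
    {x : Plane} (hx : x ∈ K.space) : ∃ f ∈ triangles K, x ∈ convexHull ℝ (f : Set Plane) := by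
  obtain ⟨s, hs, hxs⟩ := SimplicialComplex.mem_space_iff.1 hx
  obtain ⟨f, hf, hf3, hsf⟩ := hK.pure s hs
  exact ⟨f, ⟨hf, hf3⟩, convexHull_mono (by exact_mod_cast hsf) hxs⟩

theorem IsTriangulation.isCompact_space {K : SimplicialComplex ℝ Plane} (hK : IsTriangulation K) :
    IsCompact K.space :=
  hK.finite.isCompact_biUnion fun f _ => isCompact_triangle f

theorem IsTriangulation.isFiniteMeasure {K : SimplicialComplex ℝ Plane} (hK : IsTriangulation K) :
    IsFiniteMeasure (volume.restrict (domain K)) :=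
  ⟨by
    rw [Measure.restrict_apply_univ]
    exact (measure_mono interior_subset).trans_lt hK.isCompact_space.measure_lt_top⟩

theorem measurableSet_domain (K : SimplicialComplex ℝ Plane) : MeasurableSet (domain K) :=
  isOpen_interior.measurableSet

/-- The boundary of a convex set is null, and there are finitely many triangles. -/
theorem IsTriangulation.ae_mem_interior {K : SimplicialComplex ℝ Plane} (hK : IsTriangulation K) :
    ∀ᵐ x ∂(volume.restrict (domain K)),
      ∃ f ∈ triangles K, x ∈ interior (convexHull ℝ (f : Set Plane)) := by
  have h : ∀ᵐ x ∂(volume.restrict (domain K)), ∀ f ∈ triangles K,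
      x ∉ frontier (convexHull ℝ (f : Set Plane)) := by
    rw [ae_ball_iff hK.finite_triangles.countable]
    intro f _
    refine ae_restrict_of_ae ?_
    rw [ae_iff]
    simpa using (convex_convexHull ℝ (f : Set Plane)).addHaar_frontier volume
  filter_upwards [h, ae_restrict_mem (measurableSet_domain K)] with x hx hxd
  obtain ⟨f, hf, hxf⟩ := hK.exists_triangle (interior_subset hxd)
  refine ⟨f, hf, ?_⟩
  have := hx f hf
  rw [(isCompact_triangle f).isClosed.frontier_eq] at this
  by_contra h'
  exact this ⟨hxf, h'⟩

theorem restrictsTo_of_eqOn {K : SimplicialComplex ℝ Plane} {v : L2 K} {g : Plane → Plane}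
    (hv : v =ᵐ[volume.restrict (domain K)] g) {f : Finset Plane} (hf : f ∈ triangles K)
    {q : Fin 2 → MvPolynomial (Fin 2) ℝ}
    (hq : Set.EqOn g (polyField q) (convexHull ℝ (f : Set Plane))) : RestrictsTo K v f q := by
  filter_upwards [ae_triangle hf.1 hv, ae_restrict_mem isOpen_interior.measurableSet] with x hx hxf
  rw [hx, hq (interior_subset hxf)]

theorem lagrange_le_piecewisePoly (K : SimplicialComplex ℝ Plane) (p : ℕ) :
    lagrange K p ≤ piecewisePoly K p := by
  rintro v ⟨g, -, hgp, hvg⟩ f hf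
  obtain ⟨q, hq, h⟩ := hgp f hf
  exact ⟨q, hq, restrictsTo_of_eqOn hvg hf h⟩

theorem lagrange_le_continuousAtVertices (K : SimplicialComplex ℝ Plane) (p : ℕ) :
    lagrange K p ≤ continuousAtVertices K := by
  rintro v ⟨g, hg, -, hvg⟩ x hx
  have hxs : x ∈ K.space := K.subset_space hx (by simp)
  refine ⟨g x, ((hg x hxs).mono_left ?_).congr' ?_⟩
  · refine inf_le_inf_left _ ?_
    rw [le_principal_iff]
    exact mem_of_superset (self_mem_ae_restrict (measurableSet_domain K)) interior_subset
  · exact (inf_le_right : 𝓝 x ⊓ ae (volume.restrict (domain K)) ≤ _) hvg.symm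

theorem integral_lineDeriv_eq_zero {C : ℝ≥0} {h : Plane → ℝ} (hL : LipschitzWith C h)
    (hc : HasCompactSupport h) (u : Plane) : ∫ x, lineDeriv ℝ h x u = 0 := by
  -- Integration by parts against the constant `1`; the formula reverses the direction, whence `-u`.
  have := LipschitzWith.integral_lineDeriv_mul_eq (μ := (volume : Measure Plane))
    (f := fun _ => 1) (LipschitzWith.const (1 : ℝ)) hL hc (-u)
  simp only [neg_neg, mul_one] at this
  rw [← this]
  simp [lineDeriv]

/-- The closed cover consists of the triangles, where the product is smooth, and the complement of
the domain, where `φ` vanishes. -/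
theorem IsTriangulation.exists_lipschitz {K : SimplicialComplex ℝ Plane} (hK : IsTriangulation K)
    {g : Plane → Plane}
    (hg : ∀ f ∈ triangles K, ∃ q, Set.EqOn g (polyField q) (convexHull ℝ (f : Set Plane)))
    {φ : Plane → ℝ} (hφ : IsTestFunction (domain K) φ) (i : Fin 2) :
    ∃ C : ℝ≥0, LipschitzWith C fun x => φ x * g x i := by
  have hL : ∀ f : triangles K, ∃ C : ℝ≥0, LipschitzOnWith C (fun x => φ x * g x i)
      (convexHull ℝ (f.1 : Set Plane)) := by
    rintro ⟨f, hf⟩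
    obtain ⟨q, hq⟩ := hg f hf
    obtain ⟨C, hC⟩ := ((hφ.smooth.mul (contDiff_eval (q i))).contDiffOn
      (s := convexHull ℝ (f : Set Plane))).exists_lipschitzOnWith (by simp)
      (convex_convexHull ℝ _) (isCompact_triangle f)
    refine ⟨C, fun x hx y hy => ?_⟩
    have := hC hx hy
    simp only [hq hx, hq hy]
    exact this
  choose C hC using hL
  have := hK.finite_triangles.to_subtype
  obtain ⟨M, hM⟩ := (Set.finite_range C).bddAbove
  refine ⟨M, lipschitzWith_of_finite_closed_cover (ι := Option (triangles K))
    (S := fun o => o.elim (domain K)ᶜ fun f => convexHull ℝ (f.1 : Set Plane)) ?_ ?_ ?_⟩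
  · rintro (_ | f)
    · exact isOpen_interior.isClosed_compl
    · exact (isCompact_triangle f.1).isClosed
  · intro x
    by_cases hx : x ∈ domain K
    · obtain ⟨f, hf, hxf⟩ := hK.exists_triangle (interior_subset hx)
      exact ⟨some ⟨f, hf⟩, hxf⟩
    · exact ⟨none, hx⟩
  · rintro (_ | f)
    · intro x hx y hy
      have h0 : ∀ z ∈ (domain K)ᶜ, φ z = 0 := fun z hz =>
        image_eq_zero_of_notMem_tsupport fun h => hz (hφ.support h)
      simp [h0 x hx, h0 y hy]
    · exact (hC f).weaken (hM ⟨f, rfl⟩)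

/-- The weak divergence is the pointwise one, defined almost everywhere. The product rule is needed
only inside triangles; edge terms never appear, because the Lipschitz property of `φ * g i` accounts
for them. -/
theorem IsTriangulation.lagrange_le_Hdiv {K : SimplicialComplex ℝ Plane} (hK : IsTriangulation K)
    (p : ℕ) : lagrange K p ≤ Hdiv K := by
  rintro v ⟨g, -, hgp, hvg⟩
  have hfin := hK.isFiniteMeasure
  have hg : ∀ f ∈ triangles K, ∃ q, Set.EqOn g (polyField q) (convexHull ℝ (f : Set Plane)) :=
    fun f hf => let ⟨q, _, h⟩ := hgp f hf; ⟨q, h⟩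
  choose! Q hQ using hg
  have hgd : ∀ f ∈ triangles K, ∀ x ∈ interior (convexHull ℝ (f : Set Plane)),
      HasFDerivAt g (fderiv ℝ (polyField (Q f)) x) x := fun f hf x hx => by
    refine (((contDiff_polyField (Q f)).differentiable (by simp)) x).hasFDerivAt.congr_of_eventuallyEq
      ?_
    filter_upwards [isOpen_interior.mem_nhds hx] with y hy using hQ f hf (interior_subset hy)
  -- Where `g` is not differentiable `fderiv` is zero by convention. This keeps `W` measurable on
  -- the whole plane.
  set W : Plane → ℝ := fun x => ∑ i : Fin 2, (fderiv ℝ g x (EuclideanSpace.single i 1)) i with hW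
  have hWm : Measurable W := by
    refine Finset.measurable_sum _ fun i _ => ?_
    exact (by fun_prop : Measurable fun y : Plane => y i).comp
      (measurable_fderiv_apply_const ℝ g (EuclideanSpace.single i 1))
  have hWb : ∃ C : ℝ, ∀ᵐ x ∂(volume.restrict (domain K)), ‖W x‖ ≤ C := by
    have hb : ∀ f : Finset Plane, ∃ C : ℝ, ∀ x ∈ convexHull ℝ (f : Set Plane),
        ‖∑ i : Fin 2, (fderiv ℝ (polyField (Q f)) x (EuclideanSpace.single i 1)) i‖ ≤ C := by
      intro f
      refine (isCompact_triangle f).exists_bound_of_continuousOn (Continuous.continuousOn ?_)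
      refine continuous_finsetSum _ fun i _ => ?_
      exact (by fun_prop : Continuous fun y : Plane => y i).comp
        (((contDiff_polyField (Q f)).continuous_fderiv (by simp)).clm_apply continuous_const)
    choose C hC using hb
    obtain ⟨M, hM⟩ := (hK.finite_triangles.image C).bddAbove
    refine ⟨M, ?_⟩
    filter_upwards [hK.ae_mem_interior] with x ⟨f, hf, hx⟩
    simp only [hW, (hgd f hf x hx).fderiv]
    exact (hC f x (interior_subset hx)).trans (hM ⟨f, hf, rfl⟩)
  obtain ⟨M, hM⟩ := hWb
  have hWL : MemLp W 2 (volume.restrict (domain K)) :=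
    MemLp.of_bound hWm.aestronglyMeasurable M hM
  refine ⟨hWL.toLp W, fun φ hφ => ?_⟩
  rw [← add_eq_zero_iff_eq_neg, ← integral_add (hφ.integrable_fderiv v) (hφ.integrable_mul _)]
  have hLip := fun i => hK.exists_lipschitz (fun f hf => ⟨Q f, hQ f hf⟩) hφ i
  choose C hC using hLip
  have hcs : ∀ i, HasCompactSupport fun x => φ x * g x i := fun i => hφ.compact.mul_right
  have hzero : ∀ i : Fin 2, ∫ x in domain K,
      lineDeriv ℝ (fun x => φ x * g x i) x (EuclideanSpace.single i 1) = 0 := by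
    intro i
    rw [setIntegral_eq_integral_of_forall_compl_eq_zero, integral_lineDeriv_eq_zero (hC i) (hcs i)]
    intro x hx
    have hx' : x ∉ tsupport φ := fun h => hx (hφ.support h)
    rw [notMem_tsupport_iff_eventuallyEq] at hx'
    have : (fun x => φ x * g x i) =ᶠ[𝓝 x] fun _ => (0 : ℝ) := by
      filter_upwards [hx'] with y hy
      simp [hy]
    rw [this.lineDeriv_eq]
    simp [lineDeriv]
  have hint : ∀ i : Fin 2, Integrable (fun x =>
      lineDeriv ℝ (fun x => φ x * g x i) x (EuclideanSpace.single i 1))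
      (volume.restrict (domain K)) := fun i =>
    (((hC i).memLp_lineDeriv _).restrict _).integrable le_top
  calc _ = ∫ x in domain K, ∑ i : Fin 2,
        lineDeriv ℝ (fun x => φ x * g x i) x (EuclideanSpace.single i 1) := by
        refine integral_congr_ae ?_
        filter_upwards [hvg, hWL.coeFn_toLp, hK.ae_mem_interior] with x hx hw ⟨f, hf, hxf⟩
        have hd := (hgd f hf x hxf).differentiableAt
        have hφd := (hφ.smooth.differentiable (by simp)) x
        have e1 : ∀ i : Fin 2, lineDeriv ℝ (fun x => φ x * g x i) x (EuclideanSpace.single i 1) =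
            fderiv ℝ φ x (EuclideanSpace.single i 1) * g x i +
              φ x * (fderiv ℝ g x (EuclideanSpace.single i 1)) i := by
          intro i
          have h1 : HasFDerivAt (fun x => g x i)
              ((EuclideanSpace.proj i : Plane →L[ℝ] ℝ).comp (fderiv ℝ g x)) x :=
            (EuclideanSpace.proj i : Plane →L[ℝ] ℝ).hasFDerivAt.comp x hd.hasFDerivAt
          have h2 := (hφd.hasFDerivAt.mul h1).hasLineDerivAt (EuclideanSpace.single i 1)
          have h3 := h2.lineDeriv
          simp only [Pi.mul_def] at h3
          rw [h3]
          simp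
          ring
        have e2 : fderiv ℝ φ x (g x) =
            ∑ i : Fin 2, fderiv ℝ φ x (EuclideanSpace.single i 1) * g x i := by
          have : g x = ∑ i : Fin 2, g x i • EuclideanSpace.single i (1 : ℝ) := by
            ext j
            fin_cases j <;> simp
          conv_lhs => rw [this]
          simp [mul_comm]
        simp only [e1]
        rw [hx, hw, e2, Finset.sum_add_distrib, ← Finset.mul_sum, mul_comm (W x)]
    _ = 0 := by
        rw [integral_finsetSum _ fun i _ => hint i]
        simp [hzero]

theorem IsTriangulation.lagrange_le_stenberg {K : SimplicialComplex ℝ Plane}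
    (hK : IsTriangulation K) (p : ℕ) : lagrange K p ≤ stenberg K p :=
  le_inf (le_inf (hK.lagrange_le_Hdiv p) (lagrange_le_piecewisePoly K p))
    (lagrange_le_continuousAtVertices K p)

/-! ### Polynomial edge bubbles and correction of tangential traces. -/

/-- The affine polynomial whose values are `cross a b`. -/
def crossPoly (a b : Plane) : MvPolynomial (Fin 2) ℝ :=
  MvPolynomial.C (b 0 - a 0) * (MvPolynomial.X 1 - MvPolynomial.C (a 1)) -
    MvPolynomial.C (b 1 - a 1) * (MvPolynomial.X 0 - MvPolynomial.C (a 0))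

theorem eval_crossPoly (a b y : Plane) : MvPolynomial.eval y.ofLp (crossPoly a b) = cross a b y := by
  simp [crossPoly, cross]

theorem totalDegree_C_mul_le (c : ℝ) (P : MvPolynomial (Fin 2) ℝ) :
    (MvPolynomial.C c * P).totalDegree ≤ P.totalDegree :=
  (MvPolynomial.totalDegree_mul _ _).trans (by simp)

theorem totalDegree_crossPoly_le (a b : Plane) : (crossPoly a b).totalDegree ≤ 1 := by
  have h : ∀ (c d : ℝ) (i : Fin 2), (MvPolynomial.C c *
      (MvPolynomial.X i - MvPolynomial.C d) : MvPolynomial (Fin 2) ℝ).totalDegree ≤ 1 :=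
    fun c d i => (totalDegree_C_mul_le _ _).trans
      ((MvPolynomial.totalDegree_sub_C_le _ _).trans (by simp))
  exact (MvPolynomial.totalDegree_sub _ _).trans (max_le (h _ _ _) (h _ _ _))

theorem totalDegree_aeval_le (k : Polynomial ℝ) {Λ : MvPolynomial (Fin 2) ℝ}
    (hΛ : Λ.totalDegree ≤ 1) : (Polynomial.aeval Λ k).totalDegree ≤ k.natDegree := by
  rw [Polynomial.aeval_eq_sum_range]
  refine MvPolynomial.totalDegree_finsetSum_le fun i hi => ?_
  refine (MvPolynomial.totalDegree_smul_le _ _).trans ((MvPolynomial.totalDegree_pow _ _).trans ?_)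
  have : i ≤ k.natDegree := Nat.lt_succ_iff.1 (Finset.mem_range.1 hi)
  nlinarith

/-- The restriction of a polynomial to the line through `a` and `b`. -/
def restrictLine (a b : Plane) (P : MvPolynomial (Fin 2) ℝ) : Polynomial ℝ :=
  MvPolynomial.aeval (fun i => Polynomial.C (b i - a i) * Polynomial.X + Polynomial.C (a i)) P

theorem natDegree_restrictLine_le (a b : Plane) {P : MvPolynomial (Fin 2) ℝ} {p : ℕ}
    (hP : P.totalDegree ≤ p) : (restrictLine a b P).natDegree ≤ p := by
  have := MvPolynomial.aeval_natDegree_le P hP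
    (fun i => Polynomial.C (b i - a i) * Polynomial.X + Polynomial.C (a i)) (n := 1)
    (fun i => Polynomial.natDegree_linear_le)
  simpa [restrictLine] using this

theorem eval_restrictLine (a b : Plane) (P : MvPolynomial (Fin 2) ℝ) {s t : ℝ} (hst : s + t = 1) :
    (restrictLine a b P).eval t = MvPolynomial.eval (s • a + t • b).ofLp P := by
  obtain rfl : s = 1 - t := by linarith
  rw [restrictLine]
  induction P using MvPolynomial.induction_on with
  | C c => simp
  | add P Q hP hQ => simp only [map_add, Polynomial.eval_add, hP, hQ]
  | mul_X P i hP =>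
    simp only [map_mul, Polynomial.eval_mul, hP, MvPolynomial.aeval_X, MvPolynomial.eval_X]
    simp
    left
    ring

theorem exists_eq_mul_of_eval_zero_one {s : Polynomial ℝ} {p : ℕ} (hp : 2 ≤ p)
    (hs : s.natDegree ≤ p) (h0 : s.eval 0 = 0) (h1 : s.eval 1 = 0) :
    ∃ k : Polynomial ℝ, k.natDegree + 2 ≤ p ∧
      ∀ t, s.eval t = t * (1 - t) * k.eval t := by
  obtain ⟨u, rfl⟩ := Polynomial.dvd_iff_isRoot.2 (show s.IsRoot 0 from h0)
  have hu : u.IsRoot 1 := by simpa using h1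
  obtain ⟨k, rfl⟩ := Polynomial.dvd_iff_isRoot.2 hu
  -- The sign turns the factor `t * (t - 1)` into `t * (1 - t)`.
  refine ⟨-k, ?_, fun t => by simp; ring⟩
  rw [Polynomial.natDegree_neg]
  -- The zero polynomial has `natDegree` zero, so here the bound is `2 ≤ p` itself.
  by_cases hk : k = 0
  · simpa [hk] using hp
  · rw [Polynomial.natDegree_mul (Polynomial.X_sub_C_ne_zero _)
      (mul_ne_zero (Polynomial.X_sub_C_ne_zero _) hk),
      Polynomial.natDegree_mul (Polynomial.X_sub_C_ne_zero _) hk, Polynomial.natDegree_X_sub_C,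
      Polynomial.natDegree_X_sub_C] at hs
    omega

/-- A polynomial vanishing at both ends of an edge of a triangle can be changed away from that edge
so that it vanishes on the other two edges. -/
theorem exists_edge_bubble {a b c : Plane} (h : cross a b c ≠ 0) {p : ℕ} (hp : 2 ≤ p)
    {P : MvPolynomial (Fin 2) ℝ} (hP : P.totalDegree ≤ p) (ha : MvPolynomial.eval a.ofLp P = 0)
    (hb : MvPolynomial.eval b.ofLp P = 0) :
    ∃ B : MvPolynomial (Fin 2) ℝ, B.totalDegree ≤ p ∧
      (∀ y ∈ segment ℝ a b, MvPolynomial.eval y.ofLp B = MvPolynomial.eval y.ofLp P) ∧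
      (∀ y ∈ segment ℝ b c, MvPolynomial.eval y.ofLp B = 0) ∧
      ∀ y ∈ segment ℝ c a, MvPolynomial.eval y.ofLp B = 0 := by
  obtain ⟨k, hk, hkt⟩ := exists_eq_mul_of_eval_zero_one hp (natDegree_restrictLine_le a b hP)
    (by rw [eval_restrictLine a b P (add_zero 1)]; simpa using ha)
    (by rw [eval_restrictLine a b P (zero_add 1)]; simpa using hb)
  set D := cross a b c
  -- `La` and `Lb` are the barycentric coordinates at `a` and `b`. On the edge `a b` they equal `1 -
  -- t` and `t`, so `Lb * La * k(Lb)` reproduces `P` there. `La` vanishes on `b c` and `Lb` on `c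
  -- a`.
  set La := MvPolynomial.C D⁻¹ * crossPoly b c with hLa
  set Lb := MvPolynomial.C D⁻¹ * crossPoly c a with hLb
  have dLa : La.totalDegree ≤ 1 := (totalDegree_C_mul_le _ _).trans (totalDegree_crossPoly_le _ _)
  have dLb : Lb.totalDegree ≤ 1 := (totalDegree_C_mul_le _ _).trans (totalDegree_crossPoly_le _ _)
  have ev : ∀ y : Plane, MvPolynomial.eval y.ofLp (Lb * La * Polynomial.aeval Lb k) =
      (D⁻¹ * cross c a y) * (D⁻¹ * cross b c y) * k.eval (D⁻¹ * cross c a y) := by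
    intro y
    have : MvPolynomial.eval y.ofLp (Polynomial.aeval Lb k) =
        k.eval (MvPolynomial.eval y.ofLp Lb) := by
      rw [← MvPolynomial.coe_aeval_eq_eval, RingHom.coe_coe, ← Polynomial.aeval_algHom_apply]
      simp [Polynomial.aeval_def, Polynomial.eval₂_id]
    rw [map_mul, map_mul, this]
    simp only [hLa, hLb, map_mul, MvPolynomial.eval_C, eval_crossPoly]
  refine ⟨Lb * La * Polynomial.aeval Lb k, ?_, ?_, ?_, ?_⟩
  · have h1 := MvPolynomial.totalDegree_mul (Lb * La) (Polynomial.aeval Lb k)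
    have h2 := MvPolynomial.totalDegree_mul Lb La
    have h3 := totalDegree_aeval_le k dLb
    omega
  · rintro y ⟨s, t, -, -, hst, rfl⟩
    rw [← eval_restrictLine a b P hst, hkt, ev]
    have e1 : D⁻¹ * cross c a (s • a + t • b) = t := by
      rw [cross_combination _ _ _ _ _ _ hst, cross_right, cross_rotate b c a, cross_rotate a b c]
      field_simp
      ring
    have e2 : D⁻¹ * cross b c (s • a + t • b) = 1 - t := by
      rw [cross_combination _ _ _ _ _ _ hst, cross_left, cross_rotate a b c]
      field_simp
      linear_combination D * hst
    rw [e1, e2]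
  · intro y hy
    rw [ev, cross_eq_zero_of_mem_segment hy]; ring
  · intro y hy
    rw [ev, cross_eq_zero_of_mem_segment hy]; ring

theorem polyField_sub (q r : Fin 2 → MvPolynomial (Fin 2) ℝ) (x : Plane) :
    polyField (q - r) x = polyField q x - polyField r x := by
  ext i; simp [polyField]

theorem plane_inner (x y : Plane) : inner ℝ x y = x 0 * y 0 + x 1 * y 1 := by
  simp [PiLp.inner_apply, Fin.sum_univ_two, mul_comm]

/-- On the edge `a b`, the field `r` has the normal component of `q`, and its tangential component
interpolates that of `q` linearly between the endpoints. -/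
def EdgeTrace (q r : Fin 2 → MvPolynomial (Fin 2) ℝ) (a b : Plane) : Prop :=
  ∀ s t : ℝ, 0 ≤ s → 0 ≤ t → s + t = 1 →
    (∀ N : Plane, inner ℝ (b - a) N = 0 →
      inner ℝ (polyField r (s • a + t • b)) N = inner ℝ (polyField q (s • a + t • b)) N) ∧
    inner ℝ (polyField r (s • a + t • b)) (b - a) =
      s * inner ℝ (polyField q a) (b - a) + t * inner ℝ (polyField q b) (b - a)

theorem EdgeTrace.symm {q r : Fin 2 → MvPolynomial (Fin 2) ℝ} {a b : Plane}
    (h : EdgeTrace q r a b) : EdgeTrace q r b a := by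
  intro s t hs ht hst
  obtain ⟨h1, h2⟩ := h t s ht hs (by linarith)
  rw [add_comm] at h1 h2
  refine ⟨fun N hN => h1 N ?_, ?_⟩
  · rw [← neg_sub, inner_neg_left, hN, neg_zero]
  · rw [← neg_sub b a, inner_neg_right, inner_neg_right, inner_neg_right, h2]; ring

/-- The tangential bubble field on one edge of a triangle. -/
theorem exists_edge_correction {a b c : Plane} (h : cross a b c ≠ 0) {p : ℕ} (hp : 2 ≤ p)
    {q : Fin 2 → MvPolynomial (Fin 2) ℝ} (hq : q ∈ polys p) :
    ∃ B ∈ polys p,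
      (∀ s t : ℝ, 0 ≤ s → 0 ≤ t → s + t = 1 →
        (∀ N : Plane, inner ℝ (b - a) N = 0 → inner ℝ (polyField B (s • a + t • b)) N = 0) ∧
        inner ℝ (polyField B (s • a + t • b)) (b - a) =
          inner ℝ (polyField q (s • a + t • b)) (b - a) -
          (s * inner ℝ (polyField q a) (b - a) + t * inner ℝ (polyField q b) (b - a))) ∧
      (∀ y ∈ segment ℝ b c, polyField B y = 0) ∧ ∀ y ∈ segment ℝ c a, polyField B y = 0 := by
  have hab : b - a ≠ 0 := by
    intro hab
    rw [sub_eq_zero] at hab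
    subst hab
    exact h (by simp [cross])
  set n : ℝ := (b 0 - a 0) * (b 0 - a 0) + (b 1 - a 1) * (b 1 - a 1) with hn
  have hn0 : n ≠ 0 := by
    have := inner_self_ne_zero (𝕜 := ℝ).2 hab
    rwa [plane_inner] at this
  set D := cross a b c
  set ga : ℝ := inner ℝ (polyField q a) (b - a) with hga
  set gb : ℝ := inner ℝ (polyField q b) (b - a) with hgb
  -- The tangential component of `q` minus an affine polynomial that interpolates it at `a` and `b`:
  -- `D⁻¹ * crossPoly c a` is zero at `a` and one at `b`.
  set P : MvPolynomial (Fin 2) ℝ :=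
    MvPolynomial.C (b 0 - a 0) * q 0 + MvPolynomial.C (b 1 - a 1) * q 1 -
      (MvPolynomial.C ga + MvPolynomial.C ((gb - ga) * D⁻¹) * crossPoly c a) with hP
  have hPdeg : P.totalDegree ≤ p := by
    refine (MvPolynomial.totalDegree_sub _ _).trans (max_le ?_ ?_)
    · exact (MvPolynomial.totalDegree_add _ _).trans (max_le
        ((totalDegree_C_mul_le _ _).trans (hq 0)) ((totalDegree_C_mul_le _ _).trans (hq 1)))
    · refine (MvPolynomial.totalDegree_add _ _).trans (max_le (by simp) ?_)
      have := (totalDegree_C_mul_le ((gb - ga) * D⁻¹) (crossPoly c a)).trans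
        (totalDegree_crossPoly_le c a)
      omega
  have hPe : ∀ s t : ℝ, s + t = 1 → MvPolynomial.eval (s • a + t • b).ofLp P =
      inner ℝ (polyField q (s • a + t • b)) (b - a) - (s * ga + t * gb) := by
    intro s t hst
    have e1 : cross c a (s • a + t • b) = t * D := by
      rw [cross_combination _ _ _ _ _ _ hst, cross_right, cross_rotate b c a, cross_rotate a b c]
      ring
    have e2 : (s • a + t • b : Plane).ofLp = s • a.ofLp + t • b.ofLp := rfl
    rw [hP]
    simp only [map_sub, map_add, map_mul, MvPolynomial.eval_C, eval_crossPoly, e1]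
    rw [plane_inner]
    simp only [polyField, PiLp.sub_apply]
    have : (gb - ga) * D⁻¹ * (t * D) = (gb - ga) * t := by field_simp
    rw [this]
    linear_combination ga * hst
  obtain ⟨B, hB, hB1, hB2, hB3⟩ := exists_edge_bubble h hp hPdeg
    (by
      have := hPe 1 0 (by ring)
      simp only [one_smul, zero_smul, add_zero, one_mul, zero_mul, ← hga, sub_self] at this
      exact this)
    (by
      have := hPe 0 1 (by ring)
      simp only [one_smul, zero_smul, zero_add, one_mul, zero_mul, ← hgb, sub_self] at this
      exact this)
  -- The scalar bubble is put along the tangent; dividing by `n`, the squared edge length, makes its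
  -- inner product with `b - a` equal to `B`.
  have hBf : ∀ y, polyField (fun i => MvPolynomial.C ((b i - a i) * n⁻¹) * B) y =
      (MvPolynomial.eval y.ofLp B * n⁻¹) • (b - a) := by
    intro y
    ext i
    simp [polyField]
    ring
  refine ⟨fun i => MvPolynomial.C ((b i - a i) * n⁻¹) * B,
    fun i => (totalDegree_C_mul_le _ _).trans hB, ?_, ?_, ?_⟩
  · intro s t hs ht hst
    rw [hBf]
    refine ⟨fun N hN => by rw [inner_smul_left, hN, mul_zero], ?_⟩
    rw [inner_smul_left, hB1 _ ⟨s, t, hs, ht, hst, rfl⟩, hPe s t hst, plane_inner (b - a) (b - a)]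
    simp only [PiLp.sub_apply, ← hn, conj_trivial]
    field_simp
  · intro y hy
    rw [hBf, hB2 y hy]; simp
  · intro y hy
    rw [hBf, hB3 y hy]; simp

/-- Subtracting tangential edge bubbles makes the tangential traces linear. -/
theorem exists_edgeTrace {a b c : Plane} (h : cross a b c ≠ 0) {p : ℕ} (hp : 2 ≤ p)
    {q : Fin 2 → MvPolynomial (Fin 2) ℝ} (hq : q ∈ polys p) :
    ∃ r ∈ polys p, EdgeTrace q r a b ∧ EdgeTrace q r b c ∧ EdgeTrace q r c a := by
  have h' : cross b c a ≠ 0 := by rwa [cross_rotate]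
  have h'' : cross c a b ≠ 0 := by rwa [cross_rotate b c a]
  obtain ⟨B₁, m₁, e₁, f₁, g₁⟩ := exists_edge_correction h hp hq
  obtain ⟨B₂, m₂, e₂, f₂, g₂⟩ := exists_edge_correction h' hp hq
  obtain ⟨B₃, m₃, e₃, f₃, g₃⟩ := exists_edge_correction h'' hp hq
  -- On each edge the bubbles of the other two vanish, so the three corrections do not interact.
  refine ⟨q - B₁ - B₂ - B₃, sub_mem (sub_mem (sub_mem hq m₁) m₂) m₃, ?_, ?_, ?_⟩
  · intro s t hs ht hst
    obtain ⟨i₁, i₂⟩ := e₁ s t hs ht hst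
    have hy : s • a + t • b ∈ segment ℝ a b := ⟨s, t, hs, ht, hst, rfl⟩
    simp only [polyField_sub, g₂ _ hy, f₃ _ hy, sub_zero]
    exact ⟨fun N hN => by rw [inner_sub_left, i₁ N hN, sub_zero],
      by rw [inner_sub_left, i₂]; ring⟩
  · intro s t hs ht hst
    obtain ⟨i₁, i₂⟩ := e₂ s t hs ht hst
    have hy : s • b + t • c ∈ segment ℝ b c := ⟨s, t, hs, ht, hst, rfl⟩
    simp only [polyField_sub, f₁ _ hy, g₃ _ hy, sub_zero]
    exact ⟨fun N hN => by rw [inner_sub_left, i₁ N hN, sub_zero],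
      by rw [inner_sub_left, i₂]; ring⟩
  · intro s t hs ht hst
    obtain ⟨i₁, i₂⟩ := e₃ s t hs ht hst
    have hy : s • c + t • a ∈ segment ℝ c a := ⟨s, t, hs, ht, hst, rfl⟩
    simp only [polyField_sub, g₁ _ hy, f₂ _ hy, sub_zero]
    exact ⟨fun N hN => by rw [inner_sub_left, i₁ N hN, sub_zero],
      by rw [inner_sub_left, i₂]; ring⟩

theorem exists_edgeTrace_triangle {K : SimplicialComplex ℝ Plane} {f : Finset Plane}
    (hf : f ∈ triangles K) {p : ℕ} (hp : 2 ≤ p) {q : Fin 2 → MvPolynomial (Fin 2) ℝ}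
    (hq : q ∈ polys p) :
    ∃ r ∈ polys p, ∀ a ∈ f, ∀ b ∈ f, a ≠ b → EdgeTrace q r a b := by
  obtain ⟨a, b, c, rfl, hab, hac, hbc⟩ := exists_of_mem_triangles hf
  obtain ⟨r, hr, h1, h2, h3⟩ := exists_edgeTrace (cross_ne_zero_of_mem hf) hp hq
  refine ⟨r, hr, fun x hx y hy hxy => ?_⟩
  simp only [Finset.mem_insert, Finset.mem_singleton] at hx hy
  rcases hx with rfl | rfl | rfl <;> rcases hy with rfl | rfl | rfl <;>
    first
    | exact absurd rfl hxy
    | assumption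
    | (apply EdgeTrace.symm; assumption)

/-! ### Matching of vertex values and edge traces between triangles. -/

/-- The vector `b - a` rotated by a quarter turn. -/
def edgeNormal (a b : Plane) : Plane := WithLp.toLp 2 ![-(b 1 - a 1), b 0 - a 0]

theorem inner_edgeNormal (a b y : Plane) : inner ℝ (edgeNormal a b) (y - a) = cross a b y := by
  rw [plane_inner]
  simp only [edgeNormal, cross, PiLp.sub_apply, Matrix.cons_val_zero, Matrix.cons_val_one]
  ring

theorem eq_of_inner_eq {a b u v : Plane} (hab : a ≠ b)
    (h1 : inner ℝ u (b - a) = inner ℝ v (b - a))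
    (h2 : inner ℝ u (edgeNormal a b) = inner ℝ v (edgeNormal a b)) : u = v := by
  have hn0 := inner_self_ne_zero (𝕜 := ℝ).2 (sub_ne_zero.2 hab.symm)
  simp only [plane_inner, edgeNormal, PiLp.sub_apply, Matrix.cons_val_zero,
    Matrix.cons_val_one] at h1 h2 hn0
  ext i
  fin_cases i
  · apply mul_left_cancel₀ hn0
    simp only [Fin.zero_eta]
    linear_combination (b 0 - a 0) * h1 - (b 1 - a 1) * h2
  · apply mul_left_cancel₀ hn0
    simp only [Fin.mk_one]
    linear_combination (b 1 - a 1) * h1 + (b 0 - a 0) * h2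

/-- Linear interpolation is exact at the endpoint, so both components of `q` survive there. -/
theorem EdgeTrace.left_eq {q r : Fin 2 → MvPolynomial (Fin 2) ℝ} {a b : Plane} (hab : a ≠ b)
    (h : EdgeTrace q r a b) : polyField r a = polyField q a := by
  obtain ⟨h1, h2⟩ := h 1 0 zero_le_one le_rfl (by ring)
  simp only [one_smul, zero_smul, add_zero, one_mul, zero_mul] at h1 h2
  refine eq_of_inner_eq hab h2 (h1 _ ?_)
  rw [real_inner_comm, inner_edgeNormal, cross_right]

theorem continuous_polyField (q : Fin 2 → MvPolynomial (Fin 2) ℝ) : Continuous (polyField q) :=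
  (contDiff_polyField q).continuous

theorem RestrictsTo.ae_imp {K : SimplicialComplex ℝ Plane} {v : L2 K} {f : Finset Plane}
    {q : Fin 2 → MvPolynomial (Fin 2) ℝ} (h : RestrictsTo K v f q) (s : Set Plane) :
    ∀ᵐ y ∂(volume.restrict s), y ∈ interior (convexHull ℝ (f : Set Plane)) →
      v y = polyField q y :=
  ae_restrict_of_ae ((ae_restrict_iff' isOpen_interior.measurableSet).1 h)

theorem exists_eq_insert_of_mem_triangles {K : SimplicialComplex ℝ Plane} {f : Finset Plane}
    (hf : f ∈ triangles K) {a b : Plane} (ha : a ∈ f) (hb : b ∈ f) (hab : a ≠ b) :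
    ∃ c, f = {a, b, c} := by
  have h1 : ((f.erase a).erase b).card = 1 := by
    rw [Finset.card_erase_of_mem (Finset.mem_erase.2 ⟨hab.symm, hb⟩),
      Finset.card_erase_of_mem ha, hf.2]
  obtain ⟨c, hc⟩ := Finset.card_eq_one.1 h1
  refine ⟨c, ?_⟩
  rw [← hc, Finset.insert_erase (Finset.mem_erase.2 ⟨hab.symm, hb⟩), Finset.insert_erase ha]

theorem interior_triangle_nonempty {K : SimplicialComplex ℝ Plane} {f : Finset Plane}
    (hf : f ∈ triangles K) : (interior (convexHull ℝ (f : Set Plane))).Nonempty := by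
  obtain ⟨a, b, c, rfl, -, -, -⟩ := exists_of_mem_triangles hf
  have h := cross_ne_zero_of_mem hf
  have hx : (1 / 2 : ℝ) • a + (1 / 2 : ℝ) • b ∈ openSegment ℝ a b :=
    ⟨1 / 2, 1 / 2, by norm_num, by norm_num, by norm_num, rfl⟩
  have hx0 := cross_eq_zero_of_mem_segment (openSegment_subset_segment ℝ a b hx)
  set x := (1 / 2 : ℝ) • a + (1 / 2 : ℝ) • b
  have hlim : Tendsto (fun t : ℝ => (1 - t) • x + t • c) (𝓝[>] 0) (𝓝 x) := by
    have : Continuous fun t : ℝ => (1 - t) • x + t • c := by fun_prop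
    have := this.tendsto 0
    simp only [sub_zero, one_smul, zero_smul, add_zero] at this
    exact this.mono_left nhdsWithin_le_nhds
  obtain ⟨t, h1, ht⟩ := ((hlim.eventually (eventually_mem_triangle h hx)).and
    self_mem_nhdsWithin).exists
  refine ⟨_, by
    simpa using h1.2 (by
      rw [cross_combination _ _ _ _ _ _ (by ring), hx0, mul_zero, zero_add, mul_div_assoc,
        div_self h, mul_one]
      exact ht)⟩

/-- The limit of a piecewise polynomial field at a vertex is the value of its polynomial there. -/
theorem polyField_eq_of_tendsto {K : SimplicialComplex ℝ Plane} {v : L2 K} {f : Finset Plane}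
    (hf : f ∈ triangles K) {q : Fin 2 → MvPolynomial (Fin 2) ℝ} (h : RestrictsTo K v f q)
    {a c : Plane} (ha : a ∈ f) (hc : Tendsto v (𝓝 a ⊓ ae (volume.restrict (domain K))) (𝓝 c)) :
    polyField q a = c := by
  set I := interior (convexHull ℝ (f : Set Plane)) with hI
  have hcl : a ∈ closure I := by
    rw [hI, (convex_convexHull ℝ (f : Set Plane)).closure_interior_eq_closure_of_nonempty_interior
      (interior_triangle_nonempty hf)]
    exact subset_closure (subset_convexHull ℝ _ ha)
  have hle : 𝓝 a ⊓ ae (volume.restrict I) ≤ 𝓝 a ⊓ ae (volume.restrict (domain K)) :=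
    inf_le_inf_left _ (ae_mono (Measure.restrict_mono (interior_triangle_subset K hf.1) le_rfl))
  -- Limits are unique only along a nontrivial filter. Each neighbourhood of `a` meets the open
  -- triangle in positive measure, since `a` is in its closure.
  have hne : (𝓝 a ⊓ ae (volume.restrict I)).NeBot := by
    rw [inf_neBot_iff]
    intro s hs t ht
    obtain ⟨u, hus, huo, hau⟩ := mem_nhds_iff.1 hs
    have hpos : volume.restrict I u ≠ 0 := by
      rw [Measure.restrict_apply huo.measurableSet]
      exact ((huo.inter isOpen_interior).measure_pos _
        (mem_closure_iff.1 hcl u huo hau)).ne'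
    by_contra hst
    have hut : u ⊆ tᶜ := fun y hy hyt => hst ⟨y, hus hy, hyt⟩
    exact hpos (measure_mono_null hut (mem_ae_iff.1 ht))
  have h1 : Tendsto v (𝓝 a ⊓ ae (volume.restrict I)) (𝓝 (polyField q a)) :=
    (((continuous_polyField q).tendsto a).mono_left inf_le_left).congr'
      ((inf_le_right : 𝓝 a ⊓ ae (volume.restrict I) ≤ _) h.symm)
  exact tendsto_nhds_unique h1 (hc.mono_left hle)

theorem edgeNormal_ne_zero {a b : Plane} (hab : a ≠ b) : edgeNormal a b ≠ 0 := by
  intro h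
  have h0 := congrArg (fun z : Plane => z 0) h
  have h1 := congrArg (fun z : Plane => z 1) h
  simp [edgeNormal] at h0 h1
  apply hab
  ext i
  fin_cases i
  · simpa using (sub_eq_zero.1 h1).symm
  · simpa using by linarith

/-- With the sides oriented, the two triangles fill both half-discs around `x`. Hence `x` is
interior to the domain and `inner_eq_of_weakDiv` applies. -/
theorem inner_edgeNormal_eq_of_neg_of_pos {K : SimplicialComplex ℝ Plane} {v : L2 K}
    (hv : v ∈ Hdiv K) {a b c d : Plane} (hf : ({a, b, c} : Finset Plane) ∈ triangles K)
    (hf' : ({a, b, d} : Finset Plane) ∈ triangles K) (hc : cross a b c < 0)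
    (hd : 0 < cross a b d) {q q' : Fin 2 → MvPolynomial (Fin 2) ℝ}
    (hq : RestrictsTo K v {a, b, c} q) (hq' : RestrictsTo K v {a, b, d} q')
    {x : Plane} (hx : x ∈ openSegment ℝ a b) :
    inner ℝ (edgeNormal a b) (polyField q x) = inner ℝ (edgeNormal a b) (polyField q' x) := by
  obtain ⟨w, hw⟩ := hv
  have hab : a ≠ b := by
    rintro rfl
    simp [cross] at hd
  have hx0 := cross_eq_zero_of_mem_segment (openSegment_subset_segment ℝ a b hx)
  have hs : ∀ y, inner ℝ (edgeNormal a b) (y - x) = cross a b y := by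
    intro y
    rw [← sub_sub_sub_cancel_right y x a, inner_sub_right, inner_edgeNormal, inner_edgeNormal, hx0,
      sub_zero]
  obtain ⟨δ, hδ, hball⟩ := Metric.eventually_nhds_iff_ball.1
    ((eventually_mem_triangle hc.ne hx).and (eventually_mem_triangle hd.ne' hx))
  have hsub : Metric.ball x δ ⊆ domain K := by
    refine interior_maximal (fun y hy => ?_) Metric.isOpen_ball
    rcases le_total (cross a b y) 0 with h | h
    · exact SimplicialComplex.convexHull_subset_space hf.1
        (by simpa using (hball y hy).1.1 (div_nonneg_of_nonpos h hc.le))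
    · exact SimplicialComplex.convexHull_subset_space hf'.1
        (by simpa using (hball y hy).2.1 (div_nonneg h hd.le))
  refine inner_eq_of_weakDiv hδ hsub (Lp.memLp w) hw (continuous_polyField q)
    (continuous_polyField q') (edgeNormal_ne_zero hab) ?_ ?_
  · filter_upwards [hq.ae_imp (domain K)] with y hy hyb hlt
    rw [hs] at hlt
    exact hy (by simpa using (hball y hyb).1.2 (div_pos_of_neg_of_neg hlt hc))
  · filter_upwards [hq'.ae_imp (domain K)] with y hy hyb hlt
    rw [hs] at hlt
    exact hy (by simpa using (hball y hyb).2.2 (div_pos hlt hd))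

/-- Normal components of `H(div)` fields agree on the common edge of two triangles. -/
theorem inner_edgeNormal_eq {K : SimplicialComplex ℝ Plane} {v : L2 K} (hv : v ∈ Hdiv K)
    {a b c d : Plane} (hf : ({a, b, c} : Finset Plane) ∈ triangles K)
    (hf' : ({a, b, d} : Finset Plane) ∈ triangles K) (hcd : c ≠ d)
    {q q' : Fin 2 → MvPolynomial (Fin 2) ℝ}
    (hq : RestrictsTo K v {a, b, c} q) (hq' : RestrictsTo K v {a, b, d} q')
    {x : Plane} (hx : x ∈ openSegment ℝ a b) :
    inner ℝ (edgeNormal a b) (polyField q x) = inner ℝ (edgeNormal a b) (polyField q' x) := by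
  rcases mul_neg_iff.1 (cross_mul_cross_neg hf hf' hcd) with ⟨h1, h2⟩ | ⟨h1, h2⟩
  · exact (inner_edgeNormal_eq_of_neg_of_pos hv hf' hf h2 h1 hq' hq hx).symm
  · exact inner_edgeNormal_eq_of_neg_of_pos hv hf hf' h1 h2 hq hq' hx

/-- The corrected polynomials agree on the intersection of any two triangles. -/
theorem polyField_eq_of_edgeTrace {K : SimplicialComplex ℝ Plane} {v : L2 K} (hv : v ∈ Hdiv K)
    (hvc : v ∈ continuousAtVertices K) {f f' : Finset Plane} (hf : f ∈ triangles K)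
    (hf' : f' ∈ triangles K) (hff' : f ≠ f') {q q' r r' : Fin 2 → MvPolynomial (Fin 2) ℝ}
    (hq : RestrictsTo K v f q) (hq' : RestrictsTo K v f' q')
    (hr : ∀ a ∈ f, ∀ b ∈ f, a ≠ b → EdgeTrace q r a b)
    (hr' : ∀ a ∈ f', ∀ b ∈ f', a ≠ b → EdgeTrace q' r' a b) {y : Plane}
    (hy : y ∈ convexHull ℝ (f : Set Plane)) (hy' : y ∈ convexHull ℝ (f' : Set Plane)) :
    polyField r y = polyField r' y := by
  classical
  have hm := K.inter_subset_convexHull hf.1 hf'.1 ⟨hy, hy'⟩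
  rw [← Finset.coe_inter] at hm
  have hcard : (f ∩ f').card ≤ 2 := by
    by_contra! h
    have h1 : f ∩ f' = f := Finset.eq_of_subset_of_card_le Finset.inter_subset_left
      (by rw [hf.2]; omega)
    have h2 : f ∩ f' = f' := Finset.eq_of_subset_of_card_le Finset.inter_subset_right
      (by rw [hf'.2]; omega)
    exact hff' (h1.symm.trans h2)
  have hpos : 0 < (f ∩ f').card := by
    rw [Finset.card_pos]
    have := convexHull_nonempty_iff.1 (Set.nonempty_of_mem hm)
    exact_mod_cast this
  have hvertex : ∀ a ∈ f ∩ f', polyField q a = polyField q' a := by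
    intro a ha
    rw [Finset.mem_inter] at ha
    have hav : a ∈ K.vertices :=
      K.down_closed hf.1 (Finset.singleton_subset_iff.2 ha.1) (Finset.singleton_nonempty a)
    obtain ⟨c, hc⟩ := hvc a hav
    rw [polyField_eq_of_tendsto hf hq ha.1 hc, polyField_eq_of_tendsto hf' hq' ha.2 hc]
  have hkeep : ∀ {g : Finset Plane} {s t : Fin 2 → MvPolynomial (Fin 2) ℝ}, g ∈ triangles K →
      (∀ a ∈ g, ∀ b ∈ g, a ≠ b → EdgeTrace s t a b) → ∀ a ∈ g, polyField t a = polyField s a := by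
    intro g s t hg h a ha
    have hg3 := hg.2
    obtain ⟨b, hb, hba⟩ := Finset.exists_mem_ne (by omega : 1 < g.card) a
    exact (h a ha b hb hba.symm).left_eq hba.symm
  -- Distinct triangles that meet share exactly a vertex or an edge. A shared vertex needs only the
  -- continuity there.
  rcases (by omega : (f ∩ f').card = 1 ∨ (f ∩ f').card = 2) with h1 | h2
  · obtain ⟨a, ha⟩ := Finset.card_eq_one.1 h1
    have haf : a ∈ f ∩ f' := by rw [ha]; simp
    rw [ha] at hm
    simp only [Finset.coe_singleton, convexHull_singleton, Set.mem_singleton_iff] at hm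
    subst hm
    rw [hkeep hf hr _ (Finset.mem_inter.1 haf).1, hkeep hf' hr' _ (Finset.mem_inter.1 haf).2,
      hvertex _ haf]
  · obtain ⟨a, b, hab, he⟩ := Finset.card_eq_two.1 h2
    have haf : a ∈ f ∩ f' := by rw [he]; simp
    have hbf : b ∈ f ∩ f' := by rw [he]; simp
    have ha := Finset.mem_inter.1 haf
    have hb := Finset.mem_inter.1 hbf
    rw [he] at hm
    simp only [Finset.coe_insert, Finset.coe_singleton, convexHull_pair] at hm
    -- The blow-up argument covers only the open edge; the endpoints come from the vertex values.
    have hnormal : inner ℝ (edgeNormal a b) (polyField q y) =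
        inner ℝ (edgeNormal a b) (polyField q' y) := by
      rw [← insert_endpoints_openSegment] at hm
      rcases hm with rfl | rfl | hm
      · rw [hvertex _ haf]
      · rw [hvertex _ hbf]
      · obtain ⟨c, rfl⟩ := exists_eq_insert_of_mem_triangles hf ha.1 hb.1 hab
        obtain ⟨d, rfl⟩ := exists_eq_insert_of_mem_triangles hf' ha.2 hb.2 hab
        exact inner_edgeNormal_eq hv hf hf' (by rintro rfl; exact hff' rfl) hq hq' hm
    obtain ⟨s, t, hs, ht, hst, rfl⟩ := hm
    obtain ⟨i₁, i₂⟩ := hr a ha.1 b hb.1 hab s t hs ht hst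
    obtain ⟨j₁, j₂⟩ := hr' a ha.2 b hb.2 hab s t hs ht hst
    have hperp : inner ℝ (b - a) (edgeNormal a b) = 0 := by
      rw [real_inner_comm, inner_edgeNormal, cross_right]
    refine eq_of_inner_eq hab ?_ ?_
    · rw [i₂, j₂, hvertex _ haf, hvertex _ hbf]
    · rw [i₁ _ hperp, j₁ _ hperp, real_inner_comm, hnormal, real_inner_comm]

/-! ### The decomposition. -/

theorem IsTriangulation.stenberg_le {K : SimplicialComplex ℝ Plane} (hK : IsTriangulation K)
    {p : ℕ} (hp : 2 ≤ p) : stenberg K p ≤ lagrange K p ⊔ bubble K p := by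
  classical
  intro v hvs
  obtain ⟨⟨hv, hvp⟩, hvc⟩ := id hvs
  have hex : ∀ f ∈ triangles K, ∃ q r : Fin 2 → MvPolynomial (Fin 2) ℝ, RestrictsTo K v f q ∧
      r ∈ polys p ∧ ∀ a ∈ f, ∀ b ∈ f, a ≠ b → EdgeTrace q r a b := fun f hf => by
    obtain ⟨q, hq, hvq⟩ := hvp f hf
    obtain ⟨r, hr, h⟩ := exists_edgeTrace_triangle hf hp hq
    exact ⟨q, r, hvq, hr, h⟩
  choose! q r hq hr hqr using hex
  -- An arbitrary triangle containing `y` is chosen; the value does not depend on it, because the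
  -- corrected polynomials agree on intersections.
  set g : Plane → Plane := fun y =>
    if h : ∃ f ∈ triangles K, y ∈ convexHull ℝ (f : Set Plane) then polyField (r h.choose) y
    else 0 with hg
  have hgr : ∀ f ∈ triangles K, Set.EqOn g (polyField (r f)) (convexHull ℝ (f : Set Plane)) := by
    intro f hf y hy
    have h : ∃ f ∈ triangles K, y ∈ convexHull ℝ (f : Set Plane) := ⟨f, hf, hy⟩
    simp only [hg, dif_pos h]
    by_cases hff : h.choose = f
    · rw [hff]
    · exact polyField_eq_of_edgeTrace hv hvc h.choose_spec.1 hf hff (hq _ h.choose_spec.1)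
        (hq f hf) (hqr _ h.choose_spec.1) (hqr f hf) h.choose_spec.2 hy
  have hgc : ContinuousOn g K.space := by
    have := hK.finite_triangles.to_subtype
    refine ((locallyFinite_of_finite fun f : triangles K =>
      convexHull ℝ (f.1 : Set Plane)).continuousOn_iUnion
      (fun f => (isCompact_triangle f.1).isClosed)
      (fun f => (continuous_polyField (r f.1)).continuousOn.congr (hgr f.1 f.2))).mono ?_
    intro y hy
    obtain ⟨f, hf, hyf⟩ := hK.exists_triangle hy
    exact Set.mem_iUnion.2 ⟨⟨f, hf⟩, hyf⟩
  have hfin := hK.isFiniteMeasure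
  obtain ⟨C, hC⟩ := hK.isCompact_space.exists_bound_of_continuousOn hgc
  have hgL : MemLp g 2 (volume.restrict (domain K)) := by
    refine MemLp.of_bound ((hgc.mono interior_subset).aestronglyMeasurable
      (measurableSet_domain K)) C ?_
    filter_upwards [ae_restrict_mem (measurableSet_domain K)] with y hy
    exact hC y (interior_subset hy)
  have hL : hgL.toLp g ∈ lagrange K p :=
    ⟨g, hgc, fun f hf => ⟨r f, hr f hf, hgr f hf⟩, hgL.coeFn_toLp⟩
  refine Submodule.mem_sup.2 ⟨hgL.toLp g, hL, v - hgL.toLp g,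
    ⟨sub_mem hvs (hK.lagrange_le_stenberg p hL), ?_⟩, add_sub_cancel _ _⟩
  intro e he ν hν f hf hef
  -- The remainder is this polynomial on `f`, and `r f` was built with the normal trace of `q f`.
  refine ⟨q f - r f, ?_, ?_⟩
  · filter_upwards [ae_triangle hf.1 (Lp.coeFn_sub v (hgL.toLp g)), hq f hf,
      restrictsTo_of_eqOn hgL.coeFn_toLp hf (hgr f hf)] with y h1 h2 h3
    rw [h1, Pi.sub_apply, h2, h3, polyField_sub]
  · intro y hy
    obtain ⟨a, b, hab, rfl⟩ := Finset.card_eq_two.1 he.2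
    simp only [Finset.coe_insert, Finset.coe_singleton, convexHull_pair] at hy
    obtain ⟨s, t, hs, ht, hst, rfl⟩ := hy
    have := (hqr f hf a (hef (by simp)) b (hef (by simp)) hab s t hs ht hst).1 ν
      (hν.2 a (by simp) b (by simp))
    rw [polyField_sub, inner_sub_left, this, sub_self]

end StenbergDiv

end

theorem mainTheorem8 (K : Geometry.SimplicialComplex ℝ (EuclideanSpace ℝ (Fin 2)))
    (hK : StenbergDiv.IsTriangulation K) (p : ℕ) (hp : 2 ≤ p) :
    StenbergDiv.stenberg K p = StenbergDiv.lagrange K p ⊔ StenbergDiv.bubble K p :=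
  le_antisymm (hK.stenberg_le hp) (sup_le (hK.lagrange_le_stenberg p) fun _ h => h.1)
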